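/- Let $\mathbf k$ be a field of characteristic $0$; all spaces, maps and tensor products are over $\mathbf k$. A braiding on a vector space $V$ is a linear map $\sigma:V\otimes V\to V\otimes V$ (not necessarily invertible) with $\sigma_1\sigma_2\sigma_1=\sigma_2\sigma_1\sigma_2$ on $V^{\otimes 3}$, where $\sigma_i$ denotes $\sigma$ acting on the factors $i,i+1$ of $V^{\otimes n}$; a map of braided vector spaces $f:(V,\sigma)\to(W,\tau)$ is a linear map with $(f\otimes f)\sigma=\tau(f\otimes f)$. A tridendriform algebra is a vector space $R$ with bilinear operations $\prec,\succ,\cdot$ such that, with $*:=\prec+\succ+\,\cdot$, for all $x,y,z\in R$: $(x\prec y)\prec z=x\prec(y*z)$, $(x\succ y)\prec z=x\succ(y\prec z)$, $x\succ(y\succ z)=(x*y)\succ z$, $(x\cdot y)\prec z=x\cdot(y\prec z)$, $(x\prec y)\cdot z=x\cdot(y\succ z)$, $(x\succ y)\cdot z=x\succ(y\cdot z)$, $(x\cdot y)\cdot z=x\cdot(y\cdot z)$. A braided tridendriform algebra $(R,\prec,\succ,\cdot,\tau)$ is a tridendriform algebra with a braiding $\tau$ such that each $\mu\in\{\prec,\succ,\cdot\}$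 satisfies $\tau(\mathrm{id}\otimes\mu)=(\mu\otimes\mathrm{id})\tau_2\tau_1$ and $\tau(\mu\otimes\mathrm{id})=(\mathrm{id}\otimes\mu)\tau_1\tau_2$. A homomorphism of braided tridendriform algebras is a map of braided vector spaces preserving $\prec,\succ,\cdot$. Let $\mathcal D_n$ be the set of planar rooted trees with $n+1$ leaves in which every internal vertex has at least two branches; $\mathcal D_0=\{|\}$. For a vector space $V$ let $\mathcal P(V)=\bigoplus_{n\ge0}\mathbf k\mathcal D_n\otimes V^{\otimes n}$ and $\overline{\mathcal P(V)}=\bigoplus_{n\ge1}\mathbf k\mathcal D_n\otimes V^{\otimes n}$. Identify $T\otimes(v_1\otimes\cdots\otimes v_n)$ with the tree $T$ whose $n$ angles are decorated by $v_1,\dots,v_n$ from left to right, and write $T_0\vee_{v_1}\cdots\vee_{v_k}T_k$ ($k\ge1$) for the decorated tree whose root has branches $T_0,\dots,T_k$ and angles decorated by $v_1,\dots,v_k$. For $T=T_0\vee_{v_1}\cdots\vee_{v_k}T_k$ and $T'=T'_0\vee_{v_{k+1}}\cdots\vee_{v_{k+l}}T'_l$ define recursively $$T\prec_\sigma T'=T_0\vee_{v_1}\cdots\vee_{v_k}(T_k*_\sigma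 T'),\qquad T\succ_\sigma T'=(T*_\sigma T'_0)\vee_{v_{k+1}}\cdots\vee_{v_{k+l}}T'_l,$$ $$T\cdot_\sigma T'=T_0\vee_{v_1}\cdots\vee_{v_k}(T_k*_\sigma T'_0)\vee_{v_{k+1}}\cdots\vee_{v_{k+l}}T'_l,$$ where $*_\sigma=\prec_\sigma+\succ_\sigma+\,\cdot_\sigma$ on $\overline{\mathcal P(V)}$ and $|$ is the unit of $*_\sigma$. For a braiding $\sigma$ on $V$ and $m,n\ge1$ let $\beta_{m,n}:V^{\otimes m}\otimes V^{\otimes n}\to V^{\otimes n}\otimes V^{\otimes m}$ be the product $\sigma_{i_1}\cdots\sigma_{i_r}$ along a reduced expression $s_{i_1}\cdots s_{i_r}$ of the permutation $\chi_{m,n}$ given by $j\mapsto j+n$ for $j\le m$ and $j\mapsto j-m$ for $m<j\le m+n$, and let $\sigma_{AT}$ be the linear endomorphism of $\overline{\mathcal P(V)}\otimes\overline{\mathcal P(V)}$ given for $T\in\mathcal D_m$, $T'\in\mathcal D_n$ by $$\sigma_{AT}\big((T\otimes x)\otimes(T'\otimes y)\big)=(T'\otimes T)\,\beta_{m,n}(x\otimes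 y),\qquad x\in V^{\otimes m},\ y\in V^{\otimes n}.$$ **Theorem.** For every braided vector space $(V,\sigma)$, $(\overline{\mathcal P(V)},\prec_\sigma,\succ_\sigma,\cdot_\sigma,\sigma_{AT})$ together with the map $i_V:v\mapsto T[v]:=|\vee_v|$ is the free braided tridendriform algebra on $(V,\sigma)$. That is: it is a braided tridendriform algebra, $i_V$ is a map of braided vector spaces, and for every braided tridendriform algebra $(R,\prec_R,\succ_R,\cdot_R,\tau)$ and every map $\varphi:V\to R$ of braided vector spaces there is a unique homomorphism $\bar\varphi:\overline{\mathcal P(V)}\to R$ of braided tridendriform algebras with $\varphi=\bar\varphi\circ i_V$. -/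

import Mathlib

open scoped TensorProduct DirectSum

namespace BraidedTree

noncomputable section

/-! ## Braided vector spaces -/

section Braiding

variable {k : Type*} [Field k] {V : Type*} [AddCommGroup V] [Module k V]

/-- The operator `σ₁ = σ ⊗ id` on `V ⊗ V ⊗ V`. -/
def sigmaOne (σ : V ⊗[k] V →ₗ[k] V ⊗[k] V) :
    (V ⊗[k] V) ⊗[k] V →ₗ[k] (V ⊗[k] V) ⊗[k] V :=
  LinearMap.rTensor V σ

/-- The operator `σ₂ = id ⊗ σ` on `V ⊗ V ⊗ V`. -/
def sigmaTwo (σ : V ⊗[k] V →ₗ[k] V ⊗[k] V) :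
    (V ⊗[k] V) ⊗[k] V →ₗ[k] (V ⊗[k] V) ⊗[k] V :=
  (TensorProduct.assoc k V V V).symm.toLinearMap ∘ₗ LinearMap.lTensor V σ ∘ₗ
    (TensorProduct.assoc k V V V).toLinearMap

/-- `σ` is a braiding (Yang-Baxter operator): `σ₁ σ₂ σ₁ = σ₂ σ₁ σ₂`.
Invertibility is not required. -/
def IsBraiding (σ : V ⊗[k] V →ₗ[k] V ⊗[k] V) : Prop :=
  sigmaOne σ ∘ₗ sigmaTwo σ ∘ₗ sigmaOne σ = sigmaTwo σ ∘ₗ sigmaOne σ ∘ₗ sigmaTwo σ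

/-- A linear map of braided vector spaces: `(f ⊗ f) σ = τ (f ⊗ f)`. -/
def IsBraidedMap {W : Type*} [AddCommGroup W] [Module k W]
    (σ : V ⊗[k] V →ₗ[k] V ⊗[k] V) (τ : W ⊗[k] W →ₗ[k] W ⊗[k] W) (f : V →ₗ[k] W) : Prop :=
  TensorProduct.map f f ∘ₗ σ = τ ∘ₗ TensorProduct.map f f

end Braiding

/-! ## Braided tridendriform algebras -/

section Tridendriform

/-- Three bilinear operations `≺`, `≻`, `·` on a vector space. -/
structure TridendriformOps (k : Type*) [Field k] (R : Type*) [AddCommGroup R] [Module k R] where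
  prec : R →ₗ[k] R →ₗ[k] R
  succ : R →ₗ[k] R →ₗ[k] R
  dot : R →ₗ[k] R →ₗ[k] R

variable {k : Type*} [Field k] {R : Type*} [AddCommGroup R] [Module k R]

/-- The operation `* = ≺ + ≻ + ·`. -/
def TridendriformOps.star (D : TridendriformOps k R) : R →ₗ[k] R →ₗ[k] R :=
  D.prec + D.succ + D.dot

/-- The seven axioms of a tridendriform algebra. -/
structure IsTridendriform (D : TridendriformOps k R) : Prop where
  prec_prec : ∀ x y z, D.prec (D.prec x y) z = D.prec x (D.star y z)
  succ_prec : ∀ x y z, D.prec (D.succ x y) z = D.succ x (D.prec y z)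
  succ_succ : ∀ x y z, D.succ x (D.succ y z) = D.succ (D.star x y) z
  dot_prec : ∀ x y z, D.prec (D.dot x y) z = D.dot x (D.prec y z)
  prec_dot : ∀ x y z, D.dot (D.prec x y) z = D.dot x (D.succ y z)
  succ_dot : ∀ x y z, D.dot (D.succ x y) z = D.succ x (D.dot y z)
  dot_dot : ∀ x y z, D.dot (D.dot x y) z = D.dot x (D.dot y z)

/-- Compatibility of a bilinear product `μ` with `σ`:
`σ (id ⊗ μ) = (μ ⊗ id) σ₂ σ₁` and `σ (μ ⊗ id) = (id ⊗ μ) σ₁ σ₂`. -/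
def IsBraidedProduct (μ : R →ₗ[k] R →ₗ[k] R) (σ : R ⊗[k] R →ₗ[k] R ⊗[k] R) : Prop :=
  (σ ∘ₗ LinearMap.lTensor R (TensorProduct.lift μ) ∘ₗ (TensorProduct.assoc k R R R).toLinearMap
    = LinearMap.rTensor R (TensorProduct.lift μ) ∘ₗ sigmaTwo σ ∘ₗ sigmaOne σ) ∧
  (σ ∘ₗ LinearMap.rTensor R (TensorProduct.lift μ)
    = LinearMap.lTensor R (TensorProduct.lift μ) ∘ₗ (TensorProduct.assoc k R R R).toLinearMap ∘ₗ
        sigmaOne σ ∘ₗ sigmaTwo σ)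

/-- `(R, ≺, ≻, ·, σ)` is a braided tridendriform algebra. -/
structure IsBraidedTridendriform (D : TridendriformOps k R)
    (σ : R ⊗[k] R →ₗ[k] R ⊗[k] R) : Prop where
  braiding : IsBraiding σ
  tridendriform : IsTridendriform D
  prec_compat : IsBraidedProduct D.prec σ
  succ_compat : IsBraidedProduct D.succ σ
  dot_compat : IsBraidedProduct D.dot σ

/-- `f` is a homomorphism of braided tridendriform algebras. -/
structure IsBraidedTridendriformHom {S : Type*} [AddCommGroup S] [Module k S]
    (D : TridendriformOps k R) (σ : R ⊗[k] R →ₗ[k] R ⊗[k] R)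
    (E : TridendriformOps k S) (τ : S ⊗[k] S →ₗ[k] S ⊗[k] S) (f : R →ₗ[k] S) : Prop where
  map_prec : ∀ x y, f (D.prec x y) = E.prec (f x) (f y)
  map_succ : ∀ x y, f (D.succ x y) = E.succ (f x) (f y)
  map_dot : ∀ x y, f (D.dot x y) = E.dot (f x) (f y)
  braided : IsBraidedMap σ τ f

end Tridendriform

/-! ## The braiding of the tensor powers of a braided vector space -/

section TensorPowers

variable {k : Type*} [Field k] {V : Type*} [AddCommGroup V] [Module k V]

/-- For fixed `v₀ ⊗ ⋯ ⊗ vₙ₋₁`, the linear map sending `x ⊗ y` to this tensor with the entry at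
`i` replaced by `x` and the entry at `j` replaced by `y`. -/
def insertPair {n : ℕ} (i j : Fin n) (hij : i ≠ j) (v : Fin n → V) :
    V ⊗[k] V →ₗ[k] ⨂[k]^n V :=
  TensorProduct.lift <| LinearMap.mk₂ k
    (fun x y => PiTensorProduct.tprod k (Function.update (Function.update v i x) j y))
    (fun x x' y => by
      simp only [Function.update_comm hij, MultilinearMap.map_update_add])
    (fun c x y => by
      simp only [Function.update_comm hij, MultilinearMap.map_update_smul])
    (fun x y y' => by simp only [MultilinearMap.map_update_add])
    (fun c x y => by simp only [MultilinearMap.map_update_smul])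

theorem insertPair_update_left {n : ℕ} (i j : Fin n) (hij : i ≠ j) (v : Fin n → V) (x : V) :
    insertPair (k := k) i j hij (Function.update v i x) = insertPair i j hij v := by
  ext a b
  simp [insertPair]

theorem insertPair_update_right {n : ℕ} (i j : Fin n) (hij : i ≠ j) (v : Fin n → V) (x : V) :
    insertPair (k := k) i j hij (Function.update v j x) = insertPair i j hij v := by
  ext a b
  simp [insertPair, Function.update_comm hij]

theorem insertPair_update_add {n : ℕ} (i j : Fin n) (hij : i ≠ j) (v : Fin n → V) {l : Fin n}
    (hi : l ≠ i) (hj : l ≠ j) (x y : V) :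
    insertPair (k := k) i j hij (Function.update v l (x + y)) =
      insertPair i j hij (Function.update v l x) + insertPair i j hij (Function.update v l y) := by
  ext a b
  simp [insertPair, Function.update_comm hi, Function.update_comm hj]

theorem insertPair_update_smul {n : ℕ} (i j : Fin n) (hij : i ≠ j) (v : Fin n → V) {l : Fin n}
    (hi : l ≠ i) (hj : l ≠ j) (c : k) (x : V) :
    insertPair (k := k) i j hij (Function.update v l (c • x)) =
      c • insertPair i j hij (Function.update v l x) := by
  ext a b
  simp [insertPair, Function.update_comm hi, Function.update_comm hj]

/-- `σ` applied to the tensor factors `i` and `j` (in this order) of `V^{⊗ n}`. -/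
def sigmaPair (σ : V ⊗[k] V →ₗ[k] V ⊗[k] V) {n : ℕ} (i j : Fin n) (hij : i ≠ j) :
    Module.End k (⨂[k]^n V) :=
  PiTensorProduct.lift
    { toFun := fun v => insertPair i j hij v (σ (v i ⊗ₜ[k] v j))
      map_update_add' := by
        intro inst v l x y
        obtain rfl : inst = instDecidableEqFin n := Subsingleton.elim _ _
        by_cases hi : l = i
        · subst hi
          simp [insertPair_update_left, hij.symm, TensorProduct.add_tmul]
        by_cases hj : l = j
        · subst hj
          simp [insertPair_update_right, hij, TensorProduct.tmul_add]
        · simp [Ne.symm hi, Ne.symm hj, insertPair_update_add _ _ hij v hi hj]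
      map_update_smul' := by
        intro inst v l c x
        obtain rfl : inst = instDecidableEqFin n := Subsingleton.elim _ _
        by_cases hi : l = i
        · subst hi
          simp [insertPair_update_left, hij.symm, ← TensorProduct.smul_tmul']
        by_cases hj : l = j
        · subst hj
          simp [insertPair_update_right, hij]
        · simp [Ne.symm hi, Ne.symm hj, insertPair_update_smul _ _ hij v hi hj] }

/-- The operator `id^{⊗ i} ⊗ σ ⊗ id^{⊗ (n-i-2)}` on `V^{⊗ n}`, where factors are numbered from `0`
(so this is `σ_{i+1}` when they are numbered from `1`); it is only used for `i + 1 < n`. -/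
def sigmaAt (σ : V ⊗[k] V →ₗ[k] V ⊗[k] V) (n i : ℕ) : Module.End k (⨂[k]^n V) :=
  if h : i + 1 < n then
    sigmaPair σ (⟨i, by omega⟩ : Fin n) ⟨i + 1, h⟩ (by simp [Fin.ext_iff])
  else 1

/-- A reduced word, of length `m * n`, for the permutation `χ_{m,n}` that moves the first `m`
letters past the last `n` letters. The letter `i` stands for the transposition `(i, i+1)`, the
letters moved being numbered from `0`. The word is
`(n-1 ⋯ 1 0) (n ⋯ 2 1) ⋯ (m+n-2 ⋯ m m-1)`. -/
def chiWord (m n : ℕ) : List ℕ :=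
  (List.range m).flatMap fun i => (List.range n).reverse.map fun j => i + j

theorem chiWord_length (m n : ℕ) : (chiWord m n).length = m * n := by
  simp [chiWord, List.length_flatMap]

theorem chiBlock_apply (i n p : ℕ) :
    (((List.range n).reverse.map fun j => i + j).map fun l => Equiv.swap l (l + 1)).prod p =
      if p = i then i + n else if i < p ∧ p ≤ i + n then p - 1 else p := by
  induction n with
  | zero => simp; grind
  | succ n ih =>
    rw [List.range_succ, List.reverse_append, List.map_append, List.map_append, List.prod_append,
      Equiv.Perm.mul_apply, ih]
    simp only [List.reverse_singleton, List.map_cons, List.map_nil, List.prod_singleton]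
    grind

/-- The word does multiply to the permutation `χ_{m,n}`. Its length `m * n` is the number of
inversions of `χ_{m,n}`, so it is reduced. -/
theorem chiWord_apply (m n p : ℕ) :
    ((chiWord m n).map fun l => Equiv.swap l (l + 1)).prod p =
      if p < m then p + n else if p < m + n then p - m else p := by
  induction m generalizing p with
  | zero => simp [chiWord]
  | succ m ih =>
    have h : chiWord (m + 1) n = chiWord m n ++ (List.range n).reverse.map fun j => m + j := by
      simp [chiWord, List.range_succ]
    rw [h, List.map_append, List.prod_append, Equiv.Perm.mul_apply, chiBlock_apply, ih]
    grind

/-- The braiding `β_{m,n} : V^{⊗ m} ⊗ V^{⊗ n} → V^{⊗ n} ⊗ V^{⊗ m}`: the product of the `σ_i` along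
the reduced word of `χ_{m,n}`. -/
def beta (σ : V ⊗[k] V →ₗ[k] V ⊗[k] V) (m n : ℕ) :
    (⨂[k]^m V) ⊗[k] (⨂[k]^n V) →ₗ[k] (⨂[k]^n V) ⊗[k] (⨂[k]^m V) :=
  TensorPower.mulEquiv.symm.toLinearMap ∘ₗ
    (TensorPower.cast k V (Nat.add_comm m n)).toLinearMap ∘ₗ
    ((chiWord m n).map (sigmaAt σ (m + n))).prod ∘ₗ
    TensorPower.mulEquiv.toLinearMap

end TensorPowers

/-! ## Planar rooted trees and their products -/

/-- Planar rooted trees whose internal vertices all have at least two branches.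
`node T₀ [T₁, …, T_{k-1}] T_k` is the tree with branches `T₀, …, T_k`, where `k ≥ 1`, at the root. -/
inductive PTree : Type
  | leaf : PTree
  | node : PTree → List PTree → PTree → PTree

namespace PTree

mutual
/-- The number of leaves of a tree. -/
def numLeaves : PTree → ℕ
  | leaf => 1
  | node a m b => numLeaves a + numLeavesList m + numLeaves b
/-- The total number of leaves of a list of trees. -/
def numLeavesList : List PTree → ℕ
  | [] => 0
  | t :: ts => numLeaves t + numLeavesList ts
end

/-- The product `*` of two trees, as a formal sum of trees. The leaf is the unit, and otherwise
`T * T' = T ≺ T' + T ≻ T' + T · T'` with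
`T ≺ T' = T₀ ∨ ⋯ ∨ (T_k * T')`, `T ≻ T' = (T * T'₀) ∨ ⋯ ∨ T'_l` and
`T · T' = T₀ ∨ ⋯ ∨ (T_k * T'₀) ∨ ⋯ ∨ T'_l`. -/
def star : PTree → PTree → List PTree
  | leaf, T' => [T']
  | node a m b, leaf => [node a m b]
  | node a m b, node a' m' b' =>
      (star b (node a' m' b')).map (fun S => node a m S) ++
      (star (node a m b) a').map (fun S => node S m' b') ++
      (star b a').map (fun S => node a (m ++ S :: m') b')
termination_by T T' => sizeOf T + sizeOf T'

/-- `T ≺ T' = T₀ ∨ ⋯ ∨ T_{k-1} ∨ (T_k * T')` for `T = T₀ ∨ ⋯ ∨ T_k`. -/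
def prec : PTree → PTree → List PTree
  | leaf, _ => []
  | node a m b, T' => (star b T').map (fun S => node a m S)

/-- `T ≻ T' = (T * T'₀) ∨ T'₁ ∨ ⋯ ∨ T'_l` for `T' = T'₀ ∨ ⋯ ∨ T'_l`. -/
def succ : PTree → PTree → List PTree
  | _, leaf => []
  | T, node a' m' b' => (star T a').map (fun S => node S m' b')

/-- `T · T' = T₀ ∨ ⋯ ∨ T_{k-1} ∨ (T_k * T'₀) ∨ T'₁ ∨ ⋯ ∨ T'_l`
for `T = T₀ ∨ ⋯ ∨ T_k` and `T' = T'₀ ∨ ⋯ ∨ T'_l`. -/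
def dot : PTree → PTree → List PTree
  | leaf, _ => []
  | node _ _ _, leaf => []
  | node a m b, node a' m' b' => (star b a').map (fun S => node a (m ++ S :: m') b')

theorem star_eq_of_ne_leaf {T T' : PTree} (h : T ≠ leaf) (h' : T' ≠ leaf) :
    star T T' = prec T T' ++ succ T T' ++ dot T T' := by
  cases T with
  | leaf => exact absurd rfl h
  | node a m b =>
    cases T' with
    | leaf => exact absurd rfl h'
    | node a' m' b' => rw [star]; rfl

theorem numLeavesList_append (l l' : List PTree) :
    numLeavesList (l ++ l') = numLeavesList l + numLeavesList l' := by
  induction l with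
  | nil => simp [numLeavesList]
  | cons t ts ih => simp [numLeavesList, ih, Nat.add_assoc]

theorem numLeaves_of_mem_star : ∀ (T T' S : PTree), S ∈ star T T' →
    numLeaves S + 1 = numLeaves T + numLeaves T'
  | leaf, T', S, h => by
      simp only [star, List.mem_singleton] at h
      simp only [h, numLeaves]; omega
  | node a m b, leaf, S, h => by
      simp only [star, List.mem_singleton] at h
      simp only [h, numLeaves]
  | node a m b, node a' m' b', S, h => by
      simp only [star, List.mem_append, List.mem_map] at h
      rcases h with (⟨U, hU, rfl⟩ | ⟨U, hU, rfl⟩) | ⟨U, hU, rfl⟩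
      · have := numLeaves_of_mem_star _ _ _ hU
        simp only [numLeaves] at *; omega
      · have := numLeaves_of_mem_star _ _ _ hU
        simp only [numLeaves] at *; omega
      · have := numLeaves_of_mem_star _ _ _ hU
        simp only [numLeaves, numLeavesList_append, numLeavesList] at *; omega
termination_by T T' => sizeOf T + sizeOf T'

theorem numLeaves_of_mem_prec (T T' S : PTree) (h : S ∈ prec T T') :
    numLeaves S + 1 = numLeaves T + numLeaves T' := by
  cases T with
  | leaf => simp [prec] at h
  | node a m b =>
    simp only [prec, List.mem_map] at h
    obtain ⟨U, hU, rfl⟩ := h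
    have := numLeaves_of_mem_star _ _ _ hU
    simp only [numLeaves] at *; omega

theorem numLeaves_of_mem_succ (T T' S : PTree) (h : S ∈ succ T T') :
    numLeaves S + 1 = numLeaves T + numLeaves T' := by
  cases T' with
  | leaf => simp [succ] at h
  | node a m b =>
    simp only [succ, List.mem_map] at h
    obtain ⟨U, hU, rfl⟩ := h
    have := numLeaves_of_mem_star _ _ _ hU
    simp only [numLeaves] at *; omega

theorem numLeaves_of_mem_dot (T T' S : PTree) (h : S ∈ dot T T') :
    numLeaves S + 1 = numLeaves T + numLeaves T' := by
  cases T with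
  | leaf => simp [dot] at h
  | node a m b =>
    cases T' with
    | leaf => simp [dot] at h
    | node a' m' b' =>
      simp only [dot, List.mem_map] at h
      obtain ⟨U, hU, rfl⟩ := h
      have := numLeaves_of_mem_star _ _ _ hU
      simp only [numLeaves, numLeavesList_append, numLeavesList] at *; omega

end PTree

/-- The set `𝒟_n` of trees with `n + 1` leaves, that is, with `n` angles. -/
abbrev TreeOfDeg (n : ℕ) : Type := {T : PTree // T.numLeaves = n + 1}

/-! ## The space of decorated trees -/

section Space

variable (k : Type*) [Field k]

/-- The linear extension `k𝒟_m × k𝒟_n → k𝒟_p`, `p = m + n`, of a product of trees with values in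
formal sums of trees. -/
def treeProd (f : PTree → PTree → List PTree)
    (hf : ∀ T T' S, S ∈ f T T' → S.numLeaves + 1 = T.numLeaves + T'.numLeaves) {m n p : ℕ}
    (hp : m + n = p) :
    (TreeOfDeg m →₀ k) →ₗ[k] (TreeOfDeg n →₀ k) →ₗ[k] (TreeOfDeg p →₀ k) :=
  Finsupp.linearCombination k fun T : TreeOfDeg m =>
    Finsupp.linearCombination k fun T' : TreeOfDeg n =>
      ((f T.1 T'.1).attach.map fun S =>
        Finsupp.single (⟨S.1, by
          have h := hf T.1 T'.1 S.1 S.2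
          rw [T.2, T'.2] at h
          omega⟩ : TreeOfDeg p) (1 : k)).sum

variable (V : Type*) [AddCommGroup V] [Module k V]

/-- The component `𝒫_n(V) = k𝒟_n ⊗ V^{⊗ n}`; here `T ⊗ (v₁ ⊗ ⋯ ⊗ v_n)` is the tree `T` with its
angles decorated by `v₁, …, v_n` from left to right. -/
def PlanarComponent (n : ℕ) : Type _ := (TreeOfDeg n →₀ k) ⊗[k] (⨂[k]^n V)

instance (n : ℕ) : AddCommGroup (PlanarComponent k V n) :=
  inferInstanceAs (AddCommGroup ((TreeOfDeg n →₀ k) ⊗[k] (⨂[k]^n V)))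

instance (n : ℕ) : Module k (PlanarComponent k V n) :=
  inferInstanceAs (Module k ((TreeOfDeg n →₀ k) ⊗[k] (⨂[k]^n V)))

/-- The identification of `𝒫_n(V)` with `k𝒟_n ⊗ V^{⊗ n}` (the identity map). -/
def componentEquiv (n : ℕ) :
    PlanarComponent k V n ≃ₗ[k] (TreeOfDeg n →₀ k) ⊗[k] (⨂[k]^n V) :=
  LinearEquiv.refl k ((TreeOfDeg n →₀ k) ⊗[k] (⨂[k]^n V))

/-- The space `⨁_{n ≥ 1} 𝒫_n(V)`. -/
abbrev PlanarSpace : Type _ := ⨁ n : ℕ+, PlanarComponent k V (n : ℕ)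

/-- The inclusion of `𝒫_n(V)`, for `n ≥ 1`. -/
def ofComponent (n : ℕ+) : PlanarComponent k V (n : ℕ) →ₗ[k] PlanarSpace k V :=
  DirectSum.lof k ℕ+ (fun n : ℕ+ => PlanarComponent k V (n : ℕ)) n

variable {V}

/-- The product of decorated trees `(T; v₁, …, v_m)`, `(T'; v_{m+1}, …, v_{m+n})` induced by a
product of trees: in all three products of trees the angles of `T`, followed by those of `T'`,
become, from left to right, the angles of each resulting tree, and they keep their decorations. -/
def componentProd (f : PTree → PTree → List PTree)
    (hf : ∀ T T' S, S ∈ f T T' → S.numLeaves + 1 = T.numLeaves + T'.numLeaves) {m n p : ℕ}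
    (hp : m + n = p) :
    PlanarComponent k V m →ₗ[k] PlanarComponent k V n →ₗ[k] PlanarComponent k V p :=
  TensorProduct.curry <|
    (componentEquiv k V p).symm.toLinearMap ∘ₗ
    TensorProduct.map (TensorProduct.lift (treeProd k f hf hp))
      ((TensorPower.cast k V hp).toLinearMap ∘ₗ TensorPower.mulEquiv.toLinearMap) ∘ₗ
    (TensorProduct.tensorTensorTensorComm k (TreeOfDeg m →₀ k) (⨂[k]^m V)
      (TreeOfDeg n →₀ k) (⨂[k]^n V)).toLinearMap ∘ₗ
    TensorProduct.map (componentEquiv k V m).toLinearMap (componentEquiv k V n).toLinearMap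

/-- The induced bilinear product on `⨁_{n ≥ 1} 𝒫_n(V)`. -/
def planarProd (f : PTree → PTree → List PTree)
    (hf : ∀ T T' S, S ∈ f T T' → S.numLeaves + 1 = T.numLeaves + T'.numLeaves) :
    PlanarSpace k V →ₗ[k] PlanarSpace k V →ₗ[k] PlanarSpace k V :=
  DirectSum.toModule k ℕ+ _ fun m => LinearMap.flip <|
    DirectSum.toModule k ℕ+ _ fun n =>
      (componentProd k f hf (PNat.add_coe m n).symm).flip.compr₂ (ofComponent k V (m + n))

variable (V)

/-- The operations `≺_σ`, `≻_σ`, `·_σ`. -/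
def planarOps : TridendriformOps k (PlanarSpace k V) where
  prec := planarProd k PTree.prec PTree.numLeaves_of_mem_prec
  succ := planarProd k PTree.succ PTree.numLeaves_of_mem_succ
  dot := planarProd k PTree.dot PTree.numLeaves_of_mem_dot

variable {k V}

/-- The map `T ⊗ x ⊗ T' ⊗ y ↦ (T' ⊗ T) β_{m,n}(x ⊗ y)` from `𝒫_m(V) ⊗ 𝒫_n(V)` to
`𝒫_n(V) ⊗ 𝒫_m(V)`. -/
def componentBraiding (σ : V ⊗[k] V →ₗ[k] V ⊗[k] V) (m n : ℕ) :
    PlanarComponent k V m ⊗[k] PlanarComponent k V n →ₗ[k]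
      PlanarComponent k V n ⊗[k] PlanarComponent k V m :=
  TensorProduct.map (componentEquiv k V n).symm.toLinearMap
      (componentEquiv k V m).symm.toLinearMap ∘ₗ
    (TensorProduct.tensorTensorTensorComm k (TreeOfDeg n →₀ k) (TreeOfDeg m →₀ k)
      (⨂[k]^n V) (⨂[k]^m V)).toLinearMap ∘ₗ
    TensorProduct.map
      (TensorProduct.comm k (TreeOfDeg m →₀ k) (TreeOfDeg n →₀ k)).toLinearMap (beta σ m n) ∘ₗ
    (TensorProduct.tensorTensorTensorComm k (TreeOfDeg m →₀ k) (⨂[k]^m V)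
      (TreeOfDeg n →₀ k) (⨂[k]^n V)).toLinearMap ∘ₗ
    TensorProduct.map (componentEquiv k V m).toLinearMap (componentEquiv k V n).toLinearMap

/-- The braiding `σ_AT` on `⨁_{n ≥ 1} 𝒫_n(V)` induced by `σ`. -/
def sigmaAT (σ : V ⊗[k] V →ₗ[k] V ⊗[k] V) :
    PlanarSpace k V ⊗[k] PlanarSpace k V →ₗ[k] PlanarSpace k V ⊗[k] PlanarSpace k V :=
  TensorProduct.lift <|
    DirectSum.toModule k ℕ+ _ fun m => LinearMap.flip <|
      DirectSum.toModule k ℕ+ _ fun n => LinearMap.flip <|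
        TensorProduct.curry <|
          TensorProduct.map (ofComponent k V n) (ofComponent k V m) ∘ₗ
            componentBraiding σ (m : ℕ) (n : ℕ)

variable (k V)

/-- The map `v ↦ T[v] = | ∨_v |`, the tree with two leaves and its one angle decorated by `v`. -/
def planarIncl : V →ₗ[k] PlanarSpace k V :=
  ofComponent k V 1 ∘ₗ (componentEquiv k V ((1 : ℕ+) : ℕ)).symm.toLinearMap ∘ₗ
    TensorProduct.mk k (TreeOfDeg ((1 : ℕ+) : ℕ) →₀ k) (⨂[k]^((1 : ℕ+) : ℕ) V)
      (Finsupp.single ⟨PTree.node PTree.leaf [] PTree.leaf, rfl⟩ 1) ∘ₗ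
    (TensorPower.cast k V PNat.one_coe.symm).toLinearMap ∘ₗ
    (PiTensorProduct.subsingletonEquiv (R := k) (s := fun _ : Fin 1 => V)
      (0 : Fin 1)).symm.toLinearMap

end Space

end

end BraidedTree

-- The products of decorated trees merely concatenate the decorations, and `sigmaAT` merely flips
-- the two trees and moves their decorations past each other by `beta`. Hence trees and braiding can
-- be treated separately.
--
-- On the tree side, the tridendriform axioms become identities between multisets of undecorated
-- trees. In four of the seven axioms the two products modify independent branches. The other three
-- reduce to associativity of `*` on a smaller triple of trees, so all seven follow from
-- `PTree.starAssoc`, an induction on the total size.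
--
-- On the braiding side, for any product that concatenates decorations, compatibility with `sigmaAT`
-- is the factorization of `beta σ m (n + p)` and of `beta σ (m + n) p` (`beta_mul_right`,
-- `beta_mul_left`), and the braid relation for `sigmaAT` is `beta_yangBaxter`. These are identities
-- between words in the operators σ_i. They are proved inside the tensor algebra, where lengths are
-- not part of the type. The braid relation for σ enters through the rule that carries σ_i through
-- the word of χ (`sigmaTA_chiWord`).
--
-- For existence in the universal property, adjoin a unit to R as the value of the leaf. The
-- required value of a tree is then forced: T = T₀ ≻ ((v₁ ≺ T₁) · (v₂ ≺ T₂) · … · (v_k ≺ T_k)). This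
-- recursion is `treeEval`. That it turns `*` of trees into `*` in k ⊕ R is `treeEvalSum_mstar`, and
-- the three separate products are preserved for the same reason. Uniqueness holds because V
-- generates the space (`eq_top_of_planarIncl_mem`).
--
-- Generation also gives that the lift is braided (`isBraidedMap_of_generators`). The delicate point
-- is that braiding a generator past a product needs the braiding formula for a generator again
-- after the first crossing. The induction therefore also records that a generator which has crossed
-- an element is still a generator.

namespace BraidedTree

noncomputable section

-- The operators σ_i, realized on the tensor algebra.

section Words

open TensorPower (toTensorAlgebra)

variable {k : Type*} [Field k] {V : Type*} [AddCommGroup V] [Module k V]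

/-- The product of the letters of a list in the tensor algebra. -/
def tensorWord (k : Type*) [Field k] {V : Type*} [AddCommGroup V] [Module k V] (l : List V) :
    TensorAlgebra k V :=
  (l.map (TensorAlgebra.ι k)).prod

theorem tensorWord_append (l l' : List V) :
    tensorWord k (l ++ l') = tensorWord k l * tensorWord k l' := by
  simp [tensorWord]

theorem tensorWord_cons (v : V) (l : List V) :
    tensorWord k (v :: l) = TensorAlgebra.ι k v * tensorWord k l := by
  simp [tensorWord]

@[simp] theorem tensorWord_nil : tensorWord k ([] : List V) = 1 := rfl

theorem toTensorAlgebra_tprod_eq_tensorWord {n : ℕ} (v : Fin n → V) :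
    toTensorAlgebra (PiTensorProduct.tprod k v) = tensorWord k (List.ofFn v) := by
  rw [TensorPower.toTensorAlgebra_tprod, TensorAlgebra.tprod_apply, tensorWord, List.map_ofFn]
  rfl

theorem tensorWord_eq_toTensorAlgebra (l : List V) :
    tensorWord k l = toTensorAlgebra (PiTensorProduct.tprod k l.get) := by
  rw [toTensorAlgebra_tprod_eq_tensorWord, List.ofFn_get]

theorem toDirectSum_toTensorAlgebra {n : ℕ} (x : ⨂[k]^n V) :
    TensorAlgebra.toDirectSum (toTensorAlgebra x) = DirectSum.lof k ℕ (fun n => ⨂[k]^n V) n x := by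
  have h : TensorAlgebra.ofDirectSum (DirectSum.lof k ℕ (fun n => ⨂[k]^n V) n x)
      = toTensorAlgebra x :=
    DirectSum.toAddMonoid_of
      (fun _ ↦ LinearMap.toAddMonoidHom TensorPower.toTensorAlgebra) _ _
  rw [← h, TensorAlgebra.toDirectSum_ofDirectSum]

/-- This brings identities proved in the tensor algebra back to tensor powers; there, the casts
between equal exponents disappear. -/
theorem toTensorAlgebra_injective (n : ℕ) :
    Function.Injective (toTensorAlgebra : ⨂[k]^n V →ₗ[k] TensorAlgebra k V) := by
  intro x y h
  have := congrArg TensorAlgebra.toDirectSum h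
  rw [toDirectSum_toTensorAlgebra, toDirectSum_toTensorAlgebra] at this
  exact DirectSum.of_injective (β := fun n => ⨂[k]^n V) n this

theorem toTensorAlgebra_cast {m n : ℕ} (h : m = n) (x : ⨂[k]^m V) :
    toTensorAlgebra (TensorPower.cast k V h x) = toTensorAlgebra x := by
  subst h
  simp

theorem toTensorAlgebra_mulEquiv {m n : ℕ} (x : ⨂[k]^m V) (y : ⨂[k]^n V) :
    toTensorAlgebra (TensorPower.mulEquiv (x ⊗ₜ[k] y)) = toTensorAlgebra x * toTensorAlgebra y :=
  TensorPower.toTensorAlgebra_gMul x y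

/-- Linear properties of a tensor power may be checked on the tensors of lists. -/
theorem tensorPower_induction {n : ℕ} {P : TensorAlgebra k V → Prop}
    (hadd : ∀ x y, P x → P y → P (x + y)) (hsmul : ∀ (c : k) x, P x → P (c • x))
    (hword : ∀ l : List V, l.length = n → P (tensorWord k l)) (x : ⨂[k]^n V) :
    P (toTensorAlgebra x) := by
  induction x using PiTensorProduct.induction_on with
  | smul_tprod r v =>
    rw [map_smul, toTensorAlgebra_tprod_eq_tensorWord]
    exact hsmul _ _ (hword _ (by simp))
  | add x y hx hy => rw [map_add]; exact hadd _ _ hx hy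

/-- The endomorphism of the tensor algebra that is `sigmaAt σ n i` in degree `n`. -/
def sigmaTA (σ : V ⊗[k] V →ₗ[k] V ⊗[k] V) (i : ℕ) : Module.End k (TensorAlgebra k V) :=
  DirectSum.toModule k ℕ (TensorAlgebra k V)
      (fun n => (toTensorAlgebra : ⨂[k]^n V →ₗ[k] _) ∘ₗ sigmaAt σ n i) ∘ₗ
    (TensorAlgebra.toDirectSum : TensorAlgebra k V →ₐ[k] _).toLinearMap

theorem sigmaTA_toTensorAlgebra (σ : V ⊗[k] V →ₗ[k] V ⊗[k] V) (i : ℕ) {n : ℕ} (x : ⨂[k]^n V) :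
    sigmaTA σ i (toTensorAlgebra x) = toTensorAlgebra (sigmaAt σ n i x) := by
  rw [sigmaTA, LinearMap.comp_apply, AlgHom.toLinearMap_apply, toDirectSum_toTensorAlgebra,
    DirectSum.toModule_lof]
  rfl

/-- The product `V ⊗ V → T(V)`. -/
def pairTA (k V : Type*) [Field k] [AddCommGroup V] [Module k V] :
    V ⊗[k] V →ₗ[k] TensorAlgebra k V :=
  TensorProduct.lift ((LinearMap.mul k (TensorAlgebra k V)).compl₁₂
    (TensorAlgebra.ι k) (TensorAlgebra.ι k))

@[simp] theorem pairTA_tmul (v w : V) :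
    pairTA k V (v ⊗ₜ w) = TensorAlgebra.ι k v * TensorAlgebra.ι k w := rfl

theorem ofFn_update {α : Type*} {n : ℕ} (v : Fin n → α) (i : Fin n) (x : α) :
    List.ofFn (Function.update v i x) = (List.ofFn v).set i x := by
  apply List.ext_getElem
  · simp
  · intro j h1 h2
    simp only [List.getElem_ofFn, List.getElem_set, Function.update_apply, Fin.ext_iff]
    grind

/-- Translates `sigmaPair` and `insertPair` into multiplication of words; the later arguments about
σ_i rest on this form. -/
theorem sigmaTA_tensorWord (σ : V ⊗[k] V →ₗ[k] V ⊗[k] V) (l₁ l₂ : List V) (a b : V) :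
    sigmaTA σ l₁.length (tensorWord k (l₁ ++ a :: b :: l₂)) =
      tensorWord k l₁ * pairTA k V (σ (a ⊗ₜ b)) * tensorWord k l₂ := by
  have hlt : l₁.length + 1 < (l₁ ++ a :: b :: l₂).length := by simp
  rw [tensorWord_eq_toTensorAlgebra, sigmaTA_toTensorAlgebra, sigmaAt, dif_pos hlt, sigmaPair,
    PiTensorProduct.lift.tprod]
  change toTensorAlgebra (insertPair ⟨l₁.length, _⟩ ⟨l₁.length + 1, hlt⟩
    (by simp [Fin.ext_iff]) _ (σ _)) = _
  have ha : (l₁ ++ a :: b :: l₂).get ⟨l₁.length, by omega⟩ = a := by simp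
  have hb : (l₁ ++ a :: b :: l₂).get ⟨l₁.length + 1, hlt⟩ = b := by simp
  rw [ha, hb]
  generalize σ (a ⊗ₜ b) = t
  induction t using TensorProduct.induction_on with
  | zero => simp
  | add x y hx hy => simp only [map_add, mul_add, add_mul, hx, hy]
  | tmul x y =>
    simp only [insertPair, TensorProduct.lift.tmul, LinearMap.mk₂_apply,
      toTensorAlgebra_tprod_eq_tensorWord, ofFn_update, List.ofFn_get]
    simp [tensorWord_append, tensorWord_cons, mul_assoc]

theorem sigmaTA_tensorWord_of_le (σ : V ⊗[k] V →ₗ[k] V ⊗[k] V) (l : List V) {i : ℕ}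
    (h : l.length ≤ i + 1) : sigmaTA σ i (tensorWord k l) = tensorWord k l := by
  rw [tensorWord_eq_toTensorAlgebra, sigmaTA_toTensorAlgebra, sigmaAt, dif_neg (by omega)]
  rfl

theorem exists_split_pair {α : Type*} (l : List α) {i : ℕ} (h : i + 1 < l.length) :
    ∃ l₁ a b l₂, l = l₁ ++ a :: b :: l₂ ∧ l₁.length = i := by
  refine ⟨l.take i, l[i], l[i + 1], l.drop (i + 2), ?_, by simp; omega⟩
  simp

/-- The version for arbitrary tensors `t` allows iteration, since σ(a ⊗ b) is in general not a pure
tensor. -/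
theorem sigmaTA_mul_pair_mul (σ : V ⊗[k] V →ₗ[k] V ⊗[k] V) (l₁ l₂ : List V) (t : V ⊗[k] V) :
    sigmaTA σ l₁.length (tensorWord k l₁ * pairTA k V t * tensorWord k l₂) =
      tensorWord k l₁ * pairTA k V (σ t) * tensorWord k l₂ := by
  induction t using TensorProduct.induction_on with
  | zero => simp
  | add x y hx hy => simp only [map_add, mul_add, add_mul, hx, hy]
  | tmul x y =>
    rw [← sigmaTA_tensorWord]
    simp [tensorWord_append, tensorWord_cons, mul_assoc]

theorem sigmaTA_word_mul (σ : V ⊗[k] V →ₗ[k] V ⊗[k] V) (l l' : List V) {i : ℕ}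
    (h : i + 1 < l.length) :
    sigmaTA σ i (tensorWord k l * tensorWord k l') =
      sigmaTA σ i (tensorWord k l) * tensorWord k l' := by
  obtain ⟨l₁, a, b, l₂, rfl, rfl⟩ := exists_split_pair l h
  rw [← tensorWord_append, List.append_assoc, List.cons_append, List.cons_append,
    sigmaTA_tensorWord, sigmaTA_tensorWord, tensorWord_append]
  simp only [mul_assoc]

/-- No bound on `i` is needed: past the end of `l'` both operators are the identity, by the default
value in `sigmaAt`. -/
theorem sigmaTA_mul_word (σ : V ⊗[k] V →ₗ[k] V ⊗[k] V) (l l' : List V) (i : ℕ) :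
    sigmaTA σ (l.length + i) (tensorWord k l * tensorWord k l') =
      tensorWord k l * sigmaTA σ i (tensorWord k l') := by
  by_cases h : i + 1 < l'.length
  · obtain ⟨l₁, a, b, l₂, rfl, rfl⟩ := exists_split_pair l' h
    rw [← tensorWord_append, ← List.append_assoc, ← List.length_append,
      sigmaTA_tensorWord, sigmaTA_tensorWord, tensorWord_append]
    simp only [mul_assoc]
  · rw [← tensorWord_append, sigmaTA_tensorWord_of_le _ _ (by simp; omega),
      sigmaTA_tensorWord_of_le _ _ (by omega), tensorWord_append]

theorem tensorAlgebra_induction {P : TensorAlgebra k V → Prop} (hzero : P 0)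
    (hadd : ∀ x y, P x → P y → P (x + y)) (hsmul : ∀ (c : k) x, P x → P (c • x))
    (hword : ∀ l : List V, P (tensorWord k l)) (x : TensorAlgebra k V) : P x := by
  rw [← TensorAlgebra.ofDirectSum_toDirectSum x]
  induction TensorAlgebra.toDirectSum x using DirectSum.induction_on with
  | zero => rwa [map_zero]
  | add x y hx hy => rw [map_add]; exact hadd _ _ hx hy
  | of n x =>
    have h : TensorAlgebra.ofDirectSum (DirectSum.of (fun n => ⨂[k]^n V) n x)
        = toTensorAlgebra x :=
      DirectSum.toAddMonoid_of
        (fun _ ↦ LinearMap.toAddMonoidHom TensorPower.toTensorAlgebra) _ _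
    rw [h]
    exact tensorPower_induction hadd hsmul (fun l _ => hword l) x

/-- Here the bound matters: for `i + 1 ≥ m` the right side is just the product, while on the left
the operator may reach into `y`. -/
theorem sigmaTA_mul_left (σ : V ⊗[k] V →ₗ[k] V ⊗[k] V) {m i : ℕ} (h : i + 1 < m)
    (x : ⨂[k]^m V) (y : TensorAlgebra k V) :
    sigmaTA σ i (toTensorAlgebra x * y) = sigmaTA σ i (toTensorAlgebra x) * y := by
  refine tensorPower_induction (n := m) (P := fun z =>
    sigmaTA σ i (z * y) = sigmaTA σ i z * y)
    (fun x x' hx hx' => by simp only [add_mul, map_add, hx, hx'])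
    (fun c x hx => by simp only [smul_mul_assoc, map_smul, hx]) (fun l hl => ?_) x
  refine tensorAlgebra_induction (P := fun z =>
    sigmaTA σ i (tensorWord k l * z) = sigmaTA σ i (tensorWord k l) * z) (by simp)
    (fun x x' hx hx' => by simp only [mul_add, map_add, hx, hx'])
    (fun c x hx => by simp only [mul_smul_comm, map_smul, hx]) (fun l' => ?_) y
  exact sigmaTA_word_mul σ l l' (by omega)

theorem sigmaTA_mul_right (σ : V ⊗[k] V →ₗ[k] V ⊗[k] V) {m : ℕ} (i : ℕ)
    (x : ⨂[k]^m V) (y : TensorAlgebra k V) :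
    sigmaTA σ (m + i) (toTensorAlgebra x * y) = toTensorAlgebra x * sigmaTA σ i y := by
  refine tensorPower_induction (n := m) (P := fun z =>
    sigmaTA σ (m + i) (z * y) = z * sigmaTA σ i y)
    (fun x x' hx hx' => by simp only [add_mul, map_add, hx, hx'])
    (fun c x hx => by simp only [smul_mul_assoc, map_smul, hx]) (fun l hl => ?_) x
  refine tensorAlgebra_induction (P := fun z =>
    sigmaTA σ (m + i) (tensorWord k l * z) = tensorWord k l * sigmaTA σ i z) (by simp)
    (fun x x' hx hx' => by simp only [mul_add, map_add, hx, hx'])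
    (fun c x hx => by simp only [mul_smul_comm, map_smul, hx]) (fun l' => ?_) y
  subst hl
  exact sigmaTA_mul_word σ l l' i

theorem sigmaTA_word_mul_right (σ : V ⊗[k] V →ₗ[k] V ⊗[k] V) (l : List V) (i : ℕ)
    (y : TensorAlgebra k V) :
    sigmaTA σ (l.length + i) (tensorWord k l * y) = tensorWord k l * sigmaTA σ i y := by
  rw [tensorWord_eq_toTensorAlgebra, sigmaTA_mul_right]

/-- Cut the word before position `j`: one operator acts on the left piece, the other on the right
piece. If the word is shorter than `j`, the operator at `j` is the identity. -/
theorem sigmaTA_commute (σ : V ⊗[k] V →ₗ[k] V ⊗[k] V) {i j : ℕ} (h : i + 2 ≤ j)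
    (x : TensorAlgebra k V) :
    sigmaTA σ i (sigmaTA σ j x) = sigmaTA σ j (sigmaTA σ i x) := by
  refine tensorAlgebra_induction (P := fun z =>
    sigmaTA σ i (sigmaTA σ j z) = sigmaTA σ j (sigmaTA σ i z)) (by simp)
    (fun x x' hx hx' => by simp only [map_add, hx, hx'])
    (fun c x hx => by simp only [map_smul, hx]) (fun l => ?_) x
  by_cases hj : j ≤ l.length
  · obtain ⟨p, q, rfl, rfl⟩ : ∃ p q, l = p ++ q ∧ p.length = j :=
      ⟨l.take j, l.drop j, by simp, by simp; omega⟩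
    rw [tensorWord_append, ← add_zero p.length, sigmaTA_word_mul_right,
      tensorWord_eq_toTensorAlgebra p, sigmaTA_mul_left σ (by omega), sigmaTA_mul_left σ (by omega),
      sigmaTA_toTensorAlgebra, sigmaTA_mul_right]
  · rw [sigmaTA_tensorWord_of_le σ l (i := j) (by omega), tensorWord_eq_toTensorAlgebra,
      sigmaTA_toTensorAlgebra, sigmaTA_toTensorAlgebra, sigmaAt, sigmaAt,
      dif_neg (show ¬ j + 1 < l.length by omega)]
    rfl

/-- The product `V ⊗ V ⊗ V → T(V)`. -/
def tripleTA (k V : Type*) [Field k] [AddCommGroup V] [Module k V] :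
    (V ⊗[k] V) ⊗[k] V →ₗ[k] TensorAlgebra k V :=
  TensorProduct.lift ((LinearMap.mul k (TensorAlgebra k V)).compl₁₂
    (pairTA k V) (TensorAlgebra.ι k))

@[simp] theorem tripleTA_tmul (t : V ⊗[k] V) (w : V) :
    tripleTA k V (t ⊗ₜ w) = pairTA k V t * TensorAlgebra.ι k w := rfl

theorem sigmaTA_zero_tripleTA (σ : V ⊗[k] V →ₗ[k] V ⊗[k] V) (t : (V ⊗[k] V) ⊗[k] V) :
    sigmaTA σ 0 (tripleTA k V t) = tripleTA k V (sigmaOne σ t) := by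
  induction t using TensorProduct.induction_on with
  | zero => simp
  | add x y hx hy => simp only [map_add, hx, hy]
  | tmul x c =>
    have := sigmaTA_mul_pair_mul σ [] [c] x
    simpa [tensorWord_cons, sigmaOne] using this

theorem sigmaTA_one_tripleTA (σ : V ⊗[k] V →ₗ[k] V ⊗[k] V) (t : (V ⊗[k] V) ⊗[k] V) :
    sigmaTA σ 1 (tripleTA k V t) = tripleTA k V (sigmaTwo σ t) := by
  have h : sigmaTA σ 1 ∘ₗ tripleTA k V = tripleTA k V ∘ₗ sigmaTwo σ := by
    ext a b c
    have h1 := sigmaTA_mul_pair_mul σ [a] [] (b ⊗ₜ c)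
    have h2 : ∀ u : V ⊗[k] V, tripleTA k V ((TensorProduct.assoc k V V V).symm (a ⊗ₜ u)) =
        TensorAlgebra.ι k a * pairTA k V u := by
      intro u
      induction u using TensorProduct.induction_on with
      | zero => simp
      | add x y hx hy => simp only [map_add, TensorProduct.tmul_add, mul_add, hx, hy]
      | tmul x y => simp [mul_assoc]
    simpa [tensorWord_cons, sigmaTwo, h2, mul_assoc] using h1
  exact LinearMap.congr_fun h t

/-- The length bound ensures that both operators really act. For `n = i + 2` the second would be the
identity, and the relation would say σ² = σ on the last two factors. -/
theorem sigmaTA_braid {σ : V ⊗[k] V →ₗ[k] V ⊗[k] V} (hσ : IsBraiding σ) {i n : ℕ} (h : i + 2 < n)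
    (x : ⨂[k]^n V) :
    sigmaTA σ i (sigmaTA σ (i + 1) (sigmaTA σ i (toTensorAlgebra x))) =
      sigmaTA σ (i + 1) (sigmaTA σ i (sigmaTA σ (i + 1) (toTensorAlgebra x))) := by
  refine tensorPower_induction (n := n) (P := fun z =>
    sigmaTA σ i (sigmaTA σ (i + 1) (sigmaTA σ i z)) =
      sigmaTA σ (i + 1) (sigmaTA σ i (sigmaTA σ (i + 1) z)))
    (fun x x' hx hx' => by simp only [map_add, hx, hx'])
    (fun c x hx => by simp only [map_smul, hx]) (fun l hl => ?_) x
  obtain ⟨p, q, rfl, rfl⟩ : ∃ p q, l = p ++ q ∧ p.length = i :=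
    ⟨l.take i, l.drop i, by simp, by simp; omega⟩
  -- Pulling the prefix `p` out of every operator reduces to `i = 0`.
  have h0 := fun y => sigmaTA_word_mul_right σ p 0 y
  rw [add_zero] at h0
  rw [tensorWord_append]
  simp only [h0, sigmaTA_word_mul_right]
  congr 1
  obtain ⟨a, b, c, r, rfl⟩ : ∃ a b c r, q = a :: b :: c :: r := by
    match q with
    | [] | [_] | [_, _] => simp at hl; omega
    | a :: b :: c :: r => exact ⟨a, b, c, r, rfl⟩
  have hw : tensorWord k (a :: b :: c :: r) =
      tripleTA k V ((a ⊗ₜ b) ⊗ₜ c) * tensorWord k r := by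
    simp [tensorWord_cons, mul_assoc]
  -- Homogeneity of degree 3 is what lets the tail `r` be split off after each operator.
  have hdeg : ∀ t : (V ⊗[k] V) ⊗[k] V, ∃ y : ⨂[k]^3 V, tripleTA k V t = toTensorAlgebra y := by
    intro t
    suffices h : LinearMap.range (tripleTA k V) ≤
        LinearMap.range (toTensorAlgebra : ⨂[k]^3 V →ₗ[k] _) by
      obtain ⟨y, hy⟩ := h ⟨t, rfl⟩
      exact ⟨y, hy.symm⟩
    rintro _ ⟨t, rfl⟩
    induction t using TensorProduct.induction_on with
    | zero => simp
    | add x y hx hy => rw [map_add]; exact Submodule.add_mem _ hx hy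
    | tmul x c =>
      induction x using TensorProduct.induction_on with
      | zero => simp
      | add x y hx hy => rw [TensorProduct.add_tmul, map_add]; exact Submodule.add_mem _ hx hy
      | tmul a b =>
        refine ⟨PiTensorProduct.tprod k [a, b, c].get, ?_⟩
        have := tensorWord_eq_toTensorAlgebra (k := k) [a, b, c]
        simp only [tensorWord_cons, tensorWord_nil, mul_one] at this
        rw [tripleTA_tmul, pairTA_tmul, mul_assoc]
        exact this.symm
  have hmul : ∀ (j : ℕ) (_ : j + 1 < 3) (t : (V ⊗[k] V) ⊗[k] V),
      sigmaTA σ j (tripleTA k V t * tensorWord k r) =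
        sigmaTA σ j (tripleTA k V t) * tensorWord k r := by
    intro j hj t
    obtain ⟨y, hy⟩ := hdeg t
    rw [hy, sigmaTA_mul_left σ hj]
  rw [hw]
  simp only [hmul 0 (by omega), hmul 1 (by omega), sigmaTA_zero_tripleTA, sigmaTA_one_tripleTA]
  congr 2
  exact LinearMap.congr_fun hσ ((a ⊗ₜ b) ⊗ₜ c)

end Words

-- Words of operators and the identities satisfied by β.

section Beta

open TensorPower (toTensorAlgebra)

variable {k : Type*} [Field k] {V : Type*} [AddCommGroup V] [Module k V]

/-- The product of the operators `sigmaTA σ i` along a word. -/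
def wordTA (σ : V ⊗[k] V →ₗ[k] V ⊗[k] V) (w : List ℕ) : Module.End k (TensorAlgebra k V) :=
  (w.map (sigmaTA σ)).prod

theorem wordTA_append (σ : V ⊗[k] V →ₗ[k] V ⊗[k] V) (w w' : List ℕ) (x : TensorAlgebra k V) :
    wordTA σ (w ++ w') x = wordTA σ w (wordTA σ w' x) := by
  simp [wordTA]

theorem wordTA_cons (σ : V ⊗[k] V →ₗ[k] V ⊗[k] V) (i : ℕ) (w : List ℕ) (x : TensorAlgebra k V) :
    wordTA σ (i :: w) x = sigmaTA σ i (wordTA σ w x) := by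
  simp [wordTA]

@[simp] theorem wordTA_nil (σ : V ⊗[k] V →ₗ[k] V ⊗[k] V) (x : TensorAlgebra k V) :
    wordTA σ [] x = x := rfl

theorem wordTA_toTensorAlgebra (σ : V ⊗[k] V →ₗ[k] V ⊗[k] V) (w : List ℕ) {n : ℕ}
    (x : ⨂[k]^n V) :
    wordTA σ w (toTensorAlgebra x) = toTensorAlgebra ((w.map (sigmaAt σ n)).prod x) := by
  induction w with
  | nil => rfl
  | cons i w ih => rw [wordTA_cons, ih, sigmaTA_toTensorAlgebra]; simp

theorem wordTA_mul_left (σ : V ⊗[k] V →ₗ[k] V ⊗[k] V) (w : List ℕ) {m : ℕ}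
    (hw : ∀ i ∈ w, i + 1 < m) (x : ⨂[k]^m V) (y : TensorAlgebra k V) :
    wordTA σ w (toTensorAlgebra x * y) = wordTA σ w (toTensorAlgebra x) * y := by
  induction w with
  | nil => rfl
  | cons i w ih =>
    rw [wordTA_cons, wordTA_cons, ih (fun j hj => hw j (by simp [hj])), wordTA_toTensorAlgebra,
      sigmaTA_mul_left σ (hw i (by simp))]

theorem wordTA_mul_right (σ : V ⊗[k] V →ₗ[k] V ⊗[k] V) (w : List ℕ) {m : ℕ}
    (x : ⨂[k]^m V) (y : TensorAlgebra k V) :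
    wordTA σ (w.map (m + ·)) (toTensorAlgebra x * y) = toTensorAlgebra x * wordTA σ w y := by
  induction w with
  | nil => rfl
  | cons i w ih => rw [List.map_cons, wordTA_cons, wordTA_cons, ih, sigmaTA_mul_right]

theorem sigmaTA_wordTA_commute (σ : V ⊗[k] V →ₗ[k] V ⊗[k] V) (w : List ℕ) {i : ℕ}
    (hw : ∀ j ∈ w, i + 2 ≤ j ∨ j + 2 ≤ i) (x : TensorAlgebra k V) :
    sigmaTA σ i (wordTA σ w x) = wordTA σ w (sigmaTA σ i x) := by
  induction w with
  | nil => rfl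
  | cons j w ih =>
    rw [wordTA_cons, wordTA_cons, ← ih (fun j hj => hw j (by simp [hj]))]
    rcases hw j (by simp) with h | h
    · exact sigmaTA_commute σ h _
    · exact (sigmaTA_commute σ h _).symm

theorem wordTA_commute (σ : V ⊗[k] V →ₗ[k] V ⊗[k] V) (w w' : List ℕ)
    (hw : ∀ i ∈ w, ∀ j ∈ w', i + 2 ≤ j ∨ j + 2 ≤ i) (x : TensorAlgebra k V) :
    wordTA σ w (wordTA σ w' x) = wordTA σ w' (wordTA σ w x) := by
  induction w with
  | nil => rfl
  | cons i w ih =>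
    rw [wordTA_cons, wordTA_cons, ih (fun j hj => hw j (by simp [hj])),
      sigmaTA_wordTA_commute σ w' (hw i (by simp))]

/-- The word `(i + n - 1) ⋯ (i + 1) i`. -/
def chiBlock (i n : ℕ) : List ℕ := (List.range n).reverse.map fun j => i + j

theorem chiBlock_succ (i n : ℕ) : chiBlock i (n + 1) = (i + n) :: chiBlock i n := by
  simp [chiBlock, List.range_succ]

theorem mem_chiBlock {i n j : ℕ} : j ∈ chiBlock i n ↔ i ≤ j ∧ j < i + n := by
  simp only [chiBlock, List.mem_map, List.mem_reverse, List.mem_range]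
  constructor
  · rintro ⟨a, ha, rfl⟩; omega
  · intro h; exact ⟨j - i, by omega, by omega⟩

theorem chiBlock_add (i n p : ℕ) : chiBlock i (n + p) = chiBlock (i + n) p ++ chiBlock i n := by
  induction p with
  | zero => rfl
  | succ p ih => rw [← add_assoc, chiBlock_succ, ih, chiBlock_succ, List.cons_append, add_assoc]

theorem chiWord_succ (m n : ℕ) : chiWord (m + 1) n = chiWord m n ++ chiBlock m n := by
  simp [chiWord, chiBlock, List.range_succ]

theorem mem_chiWord {m n j : ℕ} (h : j ∈ chiWord m n) : j + 1 < m + n := by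
  induction m with
  | zero => simp [chiWord] at h
  | succ m ih =>
    rw [chiWord_succ, List.mem_append, mem_chiBlock] at h
    rcases h with h | h
    · have := ih h; omega
    · omega

/-- An equality of words, because `chiWord` is a concatenation of blocks indexed by its first
argument. In the second argument only the resulting operators agree. -/
theorem chiWord_add_left (m n p : ℕ) :
    chiWord (m + n) p = chiWord m p ++ (chiWord n p).map (m + ·) := by
  induction n with
  | zero => simp [chiWord]
  | succ n ih =>
    rw [← add_assoc, chiWord_succ, ih, chiWord_succ, List.map_append, List.append_assoc]
    simp [chiBlock, add_assoc]

/-- Each block splits as `chiBlock (m + n) p ++ chiBlock m n`, and the upper part must move past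
`chiWord m n`. It commutes, as its letters are at least `m + n` while those of `chiWord m n` are at
most `m + n - 2`. -/
theorem wordTA_chiWord_add_right (σ : V ⊗[k] V →ₗ[k] V ⊗[k] V) (m n p : ℕ)
    (x : TensorAlgebra k V) :
    wordTA σ (chiWord m (n + p)) x =
      wordTA σ ((chiWord m p).map (n + ·)) (wordTA σ (chiWord m n) x) := by
  induction m generalizing x with
  | zero => rfl
  | succ m ih =>
    have hb : (chiBlock m p).map (n + ·) = chiBlock (m + n) p := by
      simp [chiBlock, add_assoc, add_left_comm]
    rw [chiWord_succ, chiBlock_add, wordTA_append, wordTA_append, ih, chiWord_succ, chiWord_succ,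
      List.map_append, wordTA_append, wordTA_append, hb,
      wordTA_commute σ (chiWord m n) (chiBlock (m + n) p)]
    intro i hi j hj
    have := mem_chiWord hi
    rw [mem_chiBlock] at hj
    omega

/-- The operator commutes with the letters above `j + i + 1`, meets `j + i + 1` and `j + i` in one
braid relation that raises its index by one, and then commutes with the letters below. -/
theorem sigmaTA_chiBlock {σ : V ⊗[k] V →ₗ[k] V ⊗[k] V} (hσ : IsBraiding σ) {d i j N : ℕ}
    (hd : j + N < d) (hi : i + 1 < N) (x : ⨂[k]^d V) :
    sigmaTA σ (j + i) (wordTA σ (chiBlock j N) (toTensorAlgebra x)) =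
      wordTA σ (chiBlock j N) (sigmaTA σ (j + i + 1) (toTensorAlgebra x)) := by
  induction N with
  | zero => omega
  | succ N ih =>
    rw [chiBlock_succ, wordTA_cons, wordTA_cons]
    rcases Nat.lt_or_ge (i + 1) N with h | h
    · rw [sigmaTA_commute σ (by omega), ih (by omega) h]
    -- The top two letters of the block are now `j + i + 1` and `j + i`, so the braid relation
    -- applies.
    · obtain rfl : N = i + 1 := by omega
      rw [chiBlock_succ, wordTA_cons, wordTA_cons, ← add_assoc,
        ← sigmaTA_wordTA_commute σ (chiBlock j i), wordTA_toTensorAlgebra,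
        sigmaTA_braid hσ (by omega)]
      intro l hl
      rw [mem_chiBlock] at hl
      omega

/-- Each of the `m` blocks raises the index by one. -/
theorem sigmaTA_chiWord {σ : V ⊗[k] V →ₗ[k] V ⊗[k] V} (hσ : IsBraiding σ) {d i m N : ℕ}
    (hd : m + N ≤ d) (hi : i + 1 < N) (x : ⨂[k]^d V) :
    sigmaTA σ i (wordTA σ (chiWord m N) (toTensorAlgebra x)) =
      wordTA σ (chiWord m N) (sigmaTA σ (m + i) (toTensorAlgebra x)) := by
  induction m generalizing x with
  | zero => simp [chiWord]
  | succ m ih =>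
    rw [chiWord_succ, wordTA_append, wordTA_append, wordTA_toTensorAlgebra σ (chiBlock m N),
      ih (by omega), ← wordTA_toTensorAlgebra, sigmaTA_chiBlock hσ (by omega) hi,
      Nat.add_right_comm]

theorem wordTA_chiWord {σ : V ⊗[k] V →ₗ[k] V ⊗[k] V} (hσ : IsBraiding σ) {d m N : ℕ}
    (hd : m + N ≤ d) (w : List ℕ) (hw : ∀ i ∈ w, i + 1 < N) (x : ⨂[k]^d V) :
    wordTA σ w (wordTA σ (chiWord m N) (toTensorAlgebra x)) =
      wordTA σ (chiWord m N) (wordTA σ (w.map (m + ·)) (toTensorAlgebra x)) := by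
  induction w with
  | nil => rfl
  | cons i w ih =>
    rw [wordTA_cons, ih (fun j hj => hw j (by simp [hj])), List.map_cons, wordTA_cons,
      wordTA_toTensorAlgebra σ (w.map _), sigmaTA_chiWord hσ hd (hw i (by simp))]

/-- The braid identity for the blocks `χ_{m,n}`. -/
theorem wordTA_yangBaxter {σ : V ⊗[k] V →ₗ[k] V ⊗[k] V} (hσ : IsBraiding σ) {m n p : ℕ}
    (x : ⨂[k]^(m + n + p) V) :
    wordTA σ (chiWord n p) (wordTA σ ((chiWord m p).map (n + ·))
        (wordTA σ (chiWord m n) (toTensorAlgebra x))) =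
      wordTA σ ((chiWord m n).map (p + ·)) (wordTA σ (chiWord m p)
        (wordTA σ ((chiWord n p).map (m + ·)) (toTensorAlgebra x))) := by
  -- Reassembling the factors, each side is the word of χ_{m,n+p} combined with that of χ_{n,p},
  -- applied after it on the left and, shifted by `m`, before it on the right.
  rw [← wordTA_chiWord_add_right, ← wordTA_chiWord_add_right,
    wordTA_chiWord hσ (by omega) _ (fun i hi => mem_chiWord hi), add_comm n p]

/-- The product `V^{⊗ m} ⊗ V^{⊗ n} → T(V)`. -/
def mulTA (k V : Type*) [Field k] [AddCommGroup V] [Module k V] (m n : ℕ) :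
    (⨂[k]^m V) ⊗[k] (⨂[k]^n V) →ₗ[k] TensorAlgebra k V :=
  toTensorAlgebra ∘ₗ TensorPower.mulEquiv.toLinearMap

@[simp] theorem mulTA_tmul {m n : ℕ} (x : ⨂[k]^m V) (y : ⨂[k]^n V) :
    mulTA k V m n (x ⊗ₜ y) = toTensorAlgebra x * toTensorAlgebra y :=
  toTensorAlgebra_mulEquiv x y

theorem mulTA_injective (m n : ℕ) : Function.Injective (mulTA k V m n) :=
  (toTensorAlgebra_injective (m + n)).comp TensorPower.mulEquiv.injective

/-- The cast in `beta` is invisible in the tensor algebra, so statements about `beta` become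
statements about words. -/
theorem mulTA_beta (σ : V ⊗[k] V →ₗ[k] V ⊗[k] V) {m n : ℕ}
    (t : (⨂[k]^m V) ⊗[k] (⨂[k]^n V)) :
    mulTA k V n m (beta σ m n t) = wordTA σ (chiWord m n) (mulTA k V m n t) := by
  simp only [mulTA, beta, LinearMap.comp_apply, LinearEquiv.coe_coe, LinearEquiv.apply_symm_apply,
    toTensorAlgebra_cast, wordTA_toTensorAlgebra]

/-- The product `(V^{⊗ m} ⊗ V^{⊗ n}) ⊗ V^{⊗ p} → T(V)`. -/
def mulTA₃ (k V : Type*) [Field k] [AddCommGroup V] [Module k V] (m n p : ℕ) :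
    ((⨂[k]^m V) ⊗[k] (⨂[k]^n V)) ⊗[k] (⨂[k]^p V) →ₗ[k] TensorAlgebra k V :=
  mulTA k V (m + n) p ∘ₗ LinearMap.rTensor _ TensorPower.mulEquiv.toLinearMap

@[simp] theorem mulTA₃_tmul {m n p : ℕ} (t : (⨂[k]^m V) ⊗[k] (⨂[k]^n V)) (z : ⨂[k]^p V) :
    mulTA₃ k V m n p (t ⊗ₜ z) = mulTA k V m n t * toTensorAlgebra z := by
  simp [mulTA₃, mulTA, toTensorAlgebra_mulEquiv]

theorem mulTA₃_injective (m n p : ℕ) : Function.Injective (mulTA₃ k V m n p) := by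
  refine (mulTA_injective (m + n) p).comp ?_
  exact (LinearEquiv.rTensor (⨂[k]^p V)
    (TensorPower.mulEquiv : (⨂[k]^m V) ⊗[k] (⨂[k]^n V) ≃ₗ[k] _)).injective

theorem mulTA₃_mem (m n p : ℕ) (t : ((⨂[k]^m V) ⊗[k] (⨂[k]^n V)) ⊗[k] (⨂[k]^p V)) :
    ∃ x : ⨂[k]^(m + n + p) V, mulTA₃ k V m n p t = toTensorAlgebra x :=
  ⟨_, rfl⟩

theorem mulTA₃_assoc_symm_tmul {m n p : ℕ} (x : ⨂[k]^m V) (u : (⨂[k]^n V) ⊗[k] (⨂[k]^p V)) :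
    mulTA₃ k V m n p ((TensorProduct.assoc k _ _ _).symm (x ⊗ₜ u)) =
      toTensorAlgebra x * mulTA k V n p u := by
  induction u using TensorProduct.induction_on with
  | zero => simp
  | add u v hu hv => simp only [map_add, TensorProduct.tmul_add, mul_add, hu, hv]
  | tmul y z => simp [mul_assoc]

/-- `β_{m,n} ⊗ id`. -/
def betaOne (σ : V ⊗[k] V →ₗ[k] V ⊗[k] V) (m n p : ℕ) :
    ((⨂[k]^m V) ⊗[k] (⨂[k]^n V)) ⊗[k] (⨂[k]^p V) →ₗ[k]
      ((⨂[k]^n V) ⊗[k] (⨂[k]^m V)) ⊗[k] (⨂[k]^p V) :=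
  LinearMap.rTensor _ (beta σ m n)

/-- `id ⊗ β_{n,p}`. -/
def betaTwo (σ : V ⊗[k] V →ₗ[k] V ⊗[k] V) (m n p : ℕ) :
    ((⨂[k]^m V) ⊗[k] (⨂[k]^n V)) ⊗[k] (⨂[k]^p V) →ₗ[k]
      ((⨂[k]^m V) ⊗[k] (⨂[k]^p V)) ⊗[k] (⨂[k]^n V) :=
  (TensorProduct.assoc k _ _ _).symm.toLinearMap ∘ₗ LinearMap.lTensor _ (beta σ n p) ∘ₗ
    (TensorProduct.assoc k _ _ _).toLinearMap

theorem mulTA₃_betaOne (σ : V ⊗[k] V →ₗ[k] V ⊗[k] V) {m n p : ℕ}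
    (t : ((⨂[k]^m V) ⊗[k] (⨂[k]^n V)) ⊗[k] (⨂[k]^p V)) :
    mulTA₃ k V n m p (betaOne σ m n p t) = wordTA σ (chiWord m n) (mulTA₃ k V m n p t) := by
  induction t using TensorProduct.induction_on with
  | zero => simp
  | add u v hu hv => simp only [map_add, hu, hv]
  | tmul u z =>
    rw [betaOne, LinearMap.rTensor_tmul, mulTA₃_tmul, mulTA_beta, mulTA₃_tmul]
    exact (wordTA_mul_left σ _ (fun i hi => mem_chiWord hi) _ _).symm

theorem mulTA₃_betaTwo (σ : V ⊗[k] V →ₗ[k] V ⊗[k] V) {m n p : ℕ}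
    (t : ((⨂[k]^m V) ⊗[k] (⨂[k]^n V)) ⊗[k] (⨂[k]^p V)) :
    mulTA₃ k V m p n (betaTwo σ m n p t) =
      wordTA σ ((chiWord n p).map (m + ·)) (mulTA₃ k V m n p t) := by
  obtain ⟨s, rfl⟩ := (TensorProduct.assoc k _ _ _).symm.surjective t
  rw [betaTwo, LinearMap.comp_apply, LinearMap.comp_apply, LinearEquiv.coe_coe, LinearEquiv.coe_coe,
    LinearEquiv.apply_symm_apply]
  induction s using TensorProduct.induction_on with
  | zero => simp
  | add u v hu hv => simp only [map_add, hu, hv]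
  | tmul x u =>
    rw [LinearMap.lTensor_tmul, mulTA₃_assoc_symm_tmul, mulTA₃_assoc_symm_tmul, mulTA_beta,
      wordTA_mul_right]

theorem beta_yangBaxter {σ : V ⊗[k] V →ₗ[k] V ⊗[k] V} (hσ : IsBraiding σ) (m n p : ℕ) :
    betaOne σ n p m ∘ₗ betaTwo σ n m p ∘ₗ betaOne σ m n p =
      betaTwo σ p m n ∘ₗ betaOne σ m p n ∘ₗ betaTwo σ m n p := by
  apply LinearMap.ext
  intro t
  apply mulTA₃_injective
  obtain ⟨x, hx⟩ := mulTA₃_mem m n p t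
  simp only [LinearMap.comp_apply, mulTA₃_betaOne, mulTA₃_betaTwo, hx]
  exact wordTA_yangBaxter hσ x

/-- `β_{m,n+p}` in terms of `β_{m,n}` and `β_{m,p}`. -/
theorem beta_mul_right (σ : V ⊗[k] V →ₗ[k] V ⊗[k] V) (m n p : ℕ)
    (t : ((⨂[k]^m V) ⊗[k] (⨂[k]^n V)) ⊗[k] (⨂[k]^p V)) :
    beta σ m (n + p) (LinearMap.lTensor _ TensorPower.mulEquiv.toLinearMap
        (TensorProduct.assoc k _ _ _ t)) =
      LinearMap.rTensor _ TensorPower.mulEquiv.toLinearMap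
        (betaTwo σ n m p (betaOne σ m n p t)) := by
  apply mulTA_injective
  change _ = mulTA₃ k V n p m _
  rw [mulTA₃_betaTwo, mulTA₃_betaOne, mulTA_beta, wordTA_chiWord_add_right]
  congr 2
  obtain ⟨s, rfl⟩ := (TensorProduct.assoc k _ _ _).symm.surjective t
  rw [LinearEquiv.apply_symm_apply]
  induction s using TensorProduct.induction_on with
  | zero => simp
  | add u v hu hv => simp only [map_add, hu, hv]
  | tmul x u =>
    rw [mulTA₃_assoc_symm_tmul, LinearMap.lTensor_tmul, mulTA_tmul]
    rfl

/-- `β_{m+n,p}` in terms of `β_{m,p}` and `β_{n,p}`. -/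
theorem beta_mul_left (σ : V ⊗[k] V →ₗ[k] V ⊗[k] V) (m n p : ℕ)
    (t : ((⨂[k]^m V) ⊗[k] (⨂[k]^n V)) ⊗[k] (⨂[k]^p V)) :
    beta σ (m + n) p (LinearMap.rTensor _ TensorPower.mulEquiv.toLinearMap t) =
      LinearMap.lTensor _ TensorPower.mulEquiv.toLinearMap
        (TensorProduct.assoc k _ _ _ (betaOne σ m p n (betaTwo σ m n p t))) := by
  apply mulTA_injective
  rw [mulTA_beta, chiWord_add_left, wordTA_append]
  have h : ∀ u : ((⨂[k]^p V) ⊗[k] (⨂[k]^m V)) ⊗[k] (⨂[k]^n V),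
      mulTA k V p (m + n) (LinearMap.lTensor _ TensorPower.mulEquiv.toLinearMap
        (TensorProduct.assoc k _ _ _ u)) = mulTA₃ k V p m n u := by
    intro u
    obtain ⟨s, rfl⟩ := (TensorProduct.assoc k _ _ _).symm.surjective u
    rw [LinearEquiv.apply_symm_apply]
    induction s using TensorProduct.induction_on with
    | zero => simp
    | add u v hu hv => simp only [map_add, hu, hv]
    | tmul x u =>
      rw [mulTA₃_assoc_symm_tmul, LinearMap.lTensor_tmul, mulTA_tmul]
      rfl
  rw [h, mulTA₃_betaOne, mulTA₃_betaTwo]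
  rfl

end Beta

-- The tridendriform identities for undecorated trees.

section TreeMultisets

namespace PTree

/-- `S * T` as a multiset of trees. -/
def mstar (S T : PTree) : Multiset PTree := star S T

/-- `S ≺ T` as a multiset of trees. -/
def mprec (S T : PTree) : Multiset PTree := prec S T

/-- `S ≻ T` as a multiset of trees. -/
def msucc (S T : PTree) : Multiset PTree := succ S T

/-- `S · T` as a multiset of trees. -/
def mdot (S T : PTree) : Multiset PTree := dot S T

@[simp] theorem mstar_leaf_left (T : PTree) : mstar leaf T = {T} := by
  simp [mstar, star]

@[simp] theorem mstar_leaf_right (T : PTree) : mstar T leaf = {T} := by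
  cases T <;> simp [mstar, star]

theorem mstar_eq {T T' : PTree} (h : T ≠ leaf) (h' : T' ≠ leaf) :
    mstar T T' = mprec T T' + msucc T T' + mdot T T' := by
  simp only [mstar, mprec, msucc, mdot, star_eq_of_ne_leaf h h', Multiset.coe_add]

theorem mprec_node (a : PTree) (m : List PTree) (b T' : PTree) :
    mprec (node a m b) T' = (mstar b T').map (fun S => node a m S) := by
  simp [mprec, mstar, prec]

theorem msucc_node (T a : PTree) (m : List PTree) (b : PTree) :
    msucc T (node a m b) = (mstar T a).map (fun S => node S m b) := by
  cases T <;> simp [msucc, mstar, succ]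

theorem mdot_node (a : PTree) (m : List PTree) (b a' : PTree) (m' : List PTree) (b' : PTree) :
    mdot (node a m b) (node a' m' b') = (mstar b a').map (fun S => node a (m ++ S :: m') b') := by
  simp [mdot, mstar, dot]

theorem bind_mstar_left {s : Multiset PTree} (hs : leaf ∉ s) {T : PTree} (hT : T ≠ leaf) :
    (s.bind fun S => mstar S T) =
      (s.bind fun S => mprec S T) + (s.bind fun S => msucc S T) + s.bind fun S => mdot S T := by
  rw [← Multiset.bind_add, ← Multiset.bind_add]
  exact Multiset.bind_congr fun S hS => mstar_eq (fun h => hs (h ▸ hS)) hT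

theorem bind_mstar_right {s : Multiset PTree} (hs : leaf ∉ s) {T : PTree} (hT : T ≠ leaf) :
    (s.bind fun S => mstar T S) =
      (s.bind fun S => mprec T S) + (s.bind fun S => msucc T S) + s.bind fun S => mdot T S := by
  rw [← Multiset.bind_add, ← Multiset.bind_add]
  exact Multiset.bind_congr fun S hS => mstar_eq hT (fun h => hs (h ▸ hS))

theorem leaf_notMem_mprec {T : PTree} (hT : T ≠ leaf) (T' : PTree) : leaf ∉ mprec T T' := by
  cases T with
  | leaf => exact absurd rfl hT
  | node a m b => simp [mprec_node]

theorem leaf_notMem_msucc (T : PTree) {T' : PTree} (hT : T' ≠ leaf) : leaf ∉ msucc T T' := by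
  cases T' with
  | leaf => exact absurd rfl hT
  | node a m b => simp [msucc_node]

theorem leaf_notMem_mdot {T T' : PTree} (hT : T ≠ leaf) (hT' : T' ≠ leaf) : leaf ∉ mdot T T' := by
  cases T with
  | leaf => exact absurd rfl hT
  | node a m b =>
    cases T' with
    | leaf => exact absurd rfl hT'
    | node a' m' b' => simp [mdot_node]

theorem leaf_notMem_mstar {T T' : PTree} (hT : T ≠ leaf) (hT' : T' ≠ leaf) :
    leaf ∉ mstar T T' := by
  simp [mstar_eq hT hT', leaf_notMem_mprec hT, leaf_notMem_msucc _ hT', leaf_notMem_mdot hT hT']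

/-- Associativity of `*` for a triple of trees. -/
def StarAssoc (T T' T'' : PTree) : Prop :=
  ((mstar T T').bind fun S => mstar S T'') = (mstar T' T'').bind fun S => mstar T S

/-- Both sides change only the last branch `b`, into b * T' * T'' with the two bracketings. The same
mechanism gives `bind_msucc_msucc` and `bind_mprec_mdot`, with the products T * T' * a and b * T' *
a''. -/
theorem bind_mprec_mprec {a : PTree} {m : List PTree} {b T' T'' : PTree}
    (h : StarAssoc b T' T'') :
    ((mprec (node a m b) T').bind fun S => mprec S T'') =
      (mstar T' T'').bind fun S => mprec (node a m b) S := by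
  simp only [mprec_node, Multiset.bind_map, ← Multiset.map_bind]
  rw [h]

/-- `T` is multiplied into the first branch of `T'` and `T''` into the last one. These are distinct
branches, so the order is irrelevant and associativity is not needed. -/
theorem bind_msucc_mprec (T : PTree) {T' : PTree} (hT' : T' ≠ leaf) (T'' : PTree) :
    ((msucc T T').bind fun S => mprec S T'') = (mprec T' T'').bind fun S => msucc T S := by
  cases T' with
  | leaf => exact absurd rfl hT'
  | node a' m' b' =>
    simp only [mprec_node, msucc_node, Multiset.bind_map]
    exact Multiset.bind_map_comm _ _

theorem bind_msucc_msucc {T T' a : PTree} {m : List PTree} {b : PTree} (h : StarAssoc T T' a) :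
    ((mstar T T').bind fun S => msucc S (node a m b)) =
      (msucc T' (node a m b)).bind fun S => msucc T S := by
  simp only [msucc_node, Multiset.bind_map, ← Multiset.map_bind]
  rw [h]

theorem bind_mdot_mprec {T T' : PTree} (hT : T ≠ leaf) (hT' : T' ≠ leaf) (T'' : PTree) :
    ((mdot T T').bind fun S => mprec S T'') = (mprec T' T'').bind fun S => mdot T S := by
  cases T with
  | leaf => exact absurd rfl hT
  | node a m b =>
    cases T' with
    | leaf => exact absurd rfl hT'
    | node a' m' b' =>
      simp only [mprec_node, mdot_node, Multiset.bind_map]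
      exact Multiset.bind_map_comm _ _

theorem bind_mprec_mdot {a : PTree} {m : List PTree} {b T' a'' : PTree} {m'' : List PTree}
    {b'' : PTree} (h : StarAssoc b T' a'') :
    ((mprec (node a m b) T').bind fun S => mdot S (node a'' m'' b'')) =
      (msucc T' (node a'' m'' b'')).bind fun S => mdot (node a m b) S := by
  simp only [mprec_node, msucc_node, mdot_node, Multiset.bind_map, ← Multiset.map_bind]
  rw [h]

theorem bind_msucc_mdot (T : PTree) {T' T'' : PTree} (hT' : T' ≠ leaf) (hT'' : T'' ≠ leaf) :
    ((msucc T T').bind fun S => mdot S T'') = (mdot T' T'').bind fun S => msucc T S := by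
  cases T' with
  | leaf => exact absurd rfl hT'
  | node a m b =>
    cases T'' with
    | leaf => exact absurd rfl hT''
    | node a' m' b' =>
      simp only [msucc_node, mdot_node, Multiset.bind_map]
      exact Multiset.bind_map_comm _ _

/-- The three roots merge, and the two new branches b * a' and b' * a'' are chosen independently. -/
theorem bind_mdot_mdot {T T' T'' : PTree} (hT : T ≠ leaf) (hT' : T' ≠ leaf) (hT'' : T'' ≠ leaf) :
    ((mdot T T').bind fun S => mdot S T'') = (mdot T' T'').bind fun S => mdot T S := by
  cases T with
  | leaf => exact absurd rfl hT
  | node a m b =>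
    cases T' with
    | leaf => exact absurd rfl hT'
    | node a' m' b' =>
      cases T'' with
      | leaf => exact absurd rfl hT''
      | node a'' m'' b'' =>
        simp only [mdot_node, Multiset.bind_map, List.append_assoc, List.cons_append]
        exact Multiset.bind_map_comm _ _

theorem bind_singleton_self (s : Multiset PTree) : (s.bind fun S => {S}) = s := by
  simpa using Multiset.bind_singleton s id

/-- For three trees other than the leaf, each side expands into seven terms, matched by the seven
tridendriform identities. Three of these need associativity for a triple in which a tree is replaced
by one of its branches, hence the induction on total size. -/
theorem starAssoc : ∀ T T' T'' : PTree, StarAssoc T T' T''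
  | leaf, T', T'' => by simp [StarAssoc, bind_singleton_self]
  | node a m b, leaf, T'' => by simp [StarAssoc]
  | node a m b, node a' m' b', leaf => by simp [StarAssoc, bind_singleton_self]
  | node a m b, node a' m' b', node a'' m'' b'' => by
    have h1 := starAssoc b (node a' m' b') (node a'' m'' b'')
    have h2 := starAssoc (node a m b) (node a' m' b') a''
    have h3 := starAssoc b (node a' m' b') a''
    have n1 : node a m b ≠ leaf := by simp
    have n2 : node a' m' b' ≠ leaf := by simp
    have n3 : node a'' m'' b'' ≠ leaf := by simp
    rw [StarAssoc, bind_mstar_left (leaf_notMem_mstar n1 n2) n3,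
      bind_mstar_right (leaf_notMem_mstar n2 n3) n1, ← bind_mprec_mprec h1,
      bind_msucc_msucc h2]
    simp only [mstar_eq n1 n2, mstar_eq n2 n3, Multiset.add_bind]
    rw [bind_msucc_mprec _ n2, bind_mdot_mprec n1 n2, bind_mprec_mdot h3, bind_msucc_mdot _ n2 n3,
      bind_mdot_mdot n1 n2 n3]
    abel
termination_by T T' T'' => sizeOf T + sizeOf T' + sizeOf T''

theorem numLeaves_pos : ∀ T : PTree, 0 < numLeaves T
  | leaf => by simp [numLeaves]
  | node a m b => by have := numLeaves_pos a; simp only [numLeaves]; omega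

theorem one_lt_numLeaves {T : PTree} (h : T ≠ leaf) : 1 < numLeaves T := by
  cases T with
  | leaf => exact absurd rfl h
  | node a m b =>
    have := numLeaves_pos a
    have := numLeaves_pos b
    simp only [numLeaves]; omega

theorem ne_leaf_of_numLeaves {T : PTree} {n : ℕ+} (h : numLeaves T = n + 1) : T ≠ leaf := by
  rintro rfl
  have := n.pos
  simp [numLeaves] at h

end PTree

end TreeMultisets

-- Passing from trees to decorated trees.

section Decorated

open TensorPower (toTensorAlgebra)

variable {k : Type*} [Field k] {V : Type*} [AddCommGroup V] [Module k V]

/-- The tree `T` with its angles decorated by the component of an element of the tensor algebra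
whose degree is the number of angles; this is zero for `T = |`. -/
def decorated (T : PTree) : TensorAlgebra k V →ₗ[k] PlanarSpace k V :=
  if h : 0 < T.numLeaves - 1 then
    let n : ℕ+ := ⟨T.numLeaves - 1, h⟩
    have hn : T.numLeaves = n + 1 := (Nat.sub_add_cancel (by omega)).symm
    ofComponent k V n ∘ₗ (componentEquiv k V n).symm.toLinearMap ∘ₗ
      TensorProduct.mk k (TreeOfDeg n →₀ k) (⨂[k]^(n : ℕ) V) (Finsupp.single ⟨T, hn⟩ 1) ∘ₗ
      DirectSum.component k ℕ (fun n => ⨂[k]^n V) n ∘ₗ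
      (TensorAlgebra.toDirectSum : TensorAlgebra k V →ₐ[k] _).toLinearMap
  else 0

theorem decorated_toTensorAlgebra {T : PTree} {n : ℕ+} (h : T.numLeaves = n + 1)
    (x : ⨂[k]^(n : ℕ) V) :
    decorated T (toTensorAlgebra x) =
      ofComponent k V n ((componentEquiv k V n).symm (Finsupp.single ⟨T, h⟩ 1 ⊗ₜ x)) := by
  have hpos : 0 < T.numLeaves - 1 := by have := n.pos; omega
  obtain rfl : n = ⟨T.numLeaves - 1, hpos⟩ := PNat.eq (by rw [PNat.mk_coe]; omega)
  rw [decorated, dif_pos hpos]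
  simp only [LinearMap.comp_apply, AlgHom.toLinearMap_apply, toDirectSum_toTensorAlgebra]
  rw [DirectSum.component.lof_self]
  rfl

/-- Linear maps out of `PlanarSpace k V` agree if they agree on decorated trees. -/
theorem planarSpace_hom_ext {X : Type*} [AddCommMonoid X] [Module k X]
    {f g : PlanarSpace k V →ₗ[k] X}
    (h : ∀ (n : ℕ+) (T : PTree), T.numLeaves = n + 1 → ∀ x : ⨂[k]^(n : ℕ) V,
      f (decorated T (toTensorAlgebra x)) = g (decorated T (toTensorAlgebra x))) : f = g := by
  refine DirectSum.linearMap_ext k fun n => ?_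
  have key : (f ∘ₗ DirectSum.lof k ℕ+ (fun n : ℕ+ => PlanarComponent k V (n : ℕ)) n) ∘ₗ
        (componentEquiv k V n).symm.toLinearMap =
      (g ∘ₗ DirectSum.lof k ℕ+ (fun n : ℕ+ => PlanarComponent k V (n : ℕ)) n) ∘ₗ
        (componentEquiv k V n).symm.toLinearMap := by
    refine TensorProduct.ext (Finsupp.lhom_ext' fun T => LinearMap.ext_ring ?_)
    refine LinearMap.ext fun x => ?_
    have := h n T.1 T.2 x
    rw [decorated_toTensorAlgebra T.2] at this
    exact this
  refine LinearMap.ext fun x => ?_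
  exact LinearMap.congr_fun key x

/-- This absorbs the subtypes and casts in `treeProd` and `componentProd`: from here on a product is
a sum of trees over the concatenated decoration. -/
theorem planarProd_decorated (f : PTree → PTree → List PTree)
    (hf : ∀ T T' S, S ∈ f T T' → S.numLeaves + 1 = T.numLeaves + T'.numLeaves) {m n : ℕ+}
    {T T' : PTree} (hT : T.numLeaves = m + 1) (hT' : T'.numLeaves = n + 1)
    (x : ⨂[k]^(m : ℕ) V) (y : ⨂[k]^(n : ℕ) V) :
    planarProd k f hf (decorated T (toTensorAlgebra x)) (decorated T' (toTensorAlgebra y)) =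
      ((f T T').map fun S => decorated S (toTensorAlgebra x * toTensorAlgebra y)).sum := by
  have hp : (m : ℕ) + n = ((m + n : ℕ+) : ℕ) := (PNat.add_coe m n).symm
  have hS : ∀ S ∈ f T T', S.numLeaves = ((m + n : ℕ+) : ℕ) + 1 := by
    intro S hS
    have := hf _ _ _ hS
    omega
  have hxy : toTensorAlgebra x * toTensorAlgebra y =
      toTensorAlgebra (TensorPower.cast k V hp (TensorPower.mulEquiv (x ⊗ₜ[k] y))) := by
    rw [toTensorAlgebra_cast, toTensorAlgebra_mulEquiv]
  rw [decorated_toTensorAlgebra hT, decorated_toTensorAlgebra hT', hxy]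
  have hprod : planarProd k f hf
        (ofComponent k V m ((componentEquiv k V m).symm (Finsupp.single ⟨T, hT⟩ 1 ⊗ₜ x)))
        (ofComponent k V n ((componentEquiv k V n).symm (Finsupp.single ⟨T', hT'⟩ 1 ⊗ₜ y))) =
      ofComponent k V (m + n) (componentProd k f hf hp
        ((componentEquiv k V m).symm (Finsupp.single ⟨T, hT⟩ 1 ⊗ₜ x))
        ((componentEquiv k V n).symm (Finsupp.single ⟨T', hT'⟩ 1 ⊗ₜ y))) := by
    rw [planarProd, ofComponent, DirectSum.toModule_lof, LinearMap.flip_apply, ofComponent,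
      DirectSum.toModule_lof]
    rfl
  have hcomp : componentProd k f hf hp
        ((componentEquiv k V m).symm (Finsupp.single ⟨T, hT⟩ 1 ⊗ₜ x))
        ((componentEquiv k V n).symm (Finsupp.single ⟨T', hT'⟩ 1 ⊗ₜ y)) =
      (componentEquiv k V _).symm (treeProd k f hf hp (Finsupp.single ⟨T, hT⟩ 1)
        (Finsupp.single ⟨T', hT'⟩ 1) ⊗ₜ
          TensorPower.cast k V hp (TensorPower.mulEquiv (x ⊗ₜ[k] y))) := rfl
  rw [hprod, hcomp, treeProd, Finsupp.linearCombination_single, one_smul,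
    Finsupp.linearCombination_single, one_smul]
  generalize TensorPower.cast k V hp (TensorPower.mulEquiv (x ⊗ₜ[k] y)) = z
  have key := map_list_sum (ofComponent k V (m + n) ∘ₗ (componentEquiv k V _).symm.toLinearMap ∘ₗ
    (TensorProduct.mk k (TreeOfDeg ((m + n : ℕ+) : ℕ) →₀ k) (⨂[k]^((m + n : ℕ+) : ℕ) V)).flip z)
    ((f T T').attach.map fun S =>
      Finsupp.single (⟨S.1, hS S.1 S.2⟩ : TreeOfDeg ((m + n : ℕ+) : ℕ)) (1 : k))
  refine key.trans ?_
  conv_rhs => rw [← List.attach_map_val (l := f T T')]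
  rw [List.map_map]
  congr 1
  refine List.map_congr_left fun S _ => ?_
  exact (decorated_toTensorAlgebra (hS S.1 S.2) z).symm

/-- The sum of the trees of a multiset, all with the same decoration. -/
def decoratedSum (s : Multiset PTree) (x : TensorAlgebra k V) : PlanarSpace k V :=
  (s.map fun S => decorated S x).sum

/-- The bilinear product `μ` is induced by the product `F` of trees. -/
structure IsTreeProduct (μ : PlanarSpace k V →ₗ[k] PlanarSpace k V →ₗ[k] PlanarSpace k V)
    (F : PTree → PTree → Multiset PTree) : Prop where
  numLeaves : ∀ {T T' S : PTree}, T ≠ .leaf → T' ≠ .leaf → S ∈ F T T' →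
    S.numLeaves + 1 = T.numLeaves + T'.numLeaves
  apply : ∀ {m n : ℕ+} {T T' : PTree}, T.numLeaves = m + 1 → T'.numLeaves = n + 1 →
    ∀ (x : ⨂[k]^(m : ℕ) V) (y : ⨂[k]^(n : ℕ) V),
    μ (decorated T (toTensorAlgebra x)) (decorated T' (toTensorAlgebra y)) =
      decoratedSum (F T T') (toTensorAlgebra x * toTensorAlgebra y)

theorem isTreeProduct_planarProd (f : PTree → PTree → List PTree)
    (hf : ∀ T T' S, S ∈ f T T' → S.numLeaves + 1 = T.numLeaves + T'.numLeaves) :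
    IsTreeProduct (planarProd k f hf : PlanarSpace k V →ₗ[k] _) fun T T' => f T T' where
  numLeaves _ _ h := hf _ _ _ (by simpa using h)
  apply hT hT' x y := by
    rw [planarProd_decorated f hf hT hT', decoratedSum, Multiset.map_coe, Multiset.sum_coe]

theorem isTreeProduct_prec : IsTreeProduct (planarOps k V).prec PTree.mprec :=
  isTreeProduct_planarProd _ _

theorem isTreeProduct_succ : IsTreeProduct (planarOps k V).succ PTree.msucc :=
  isTreeProduct_planarProd _ _

theorem isTreeProduct_dot : IsTreeProduct (planarOps k V).dot PTree.mdot :=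
  isTreeProduct_planarProd _ _

theorem isTreeProduct_star : IsTreeProduct (planarOps k V).star PTree.mstar where
  numLeaves _ _ h := PTree.numLeaves_of_mem_star _ _ _ (by simpa [PTree.mstar] using h)
  apply hT hT' x y := by
    rw [TridendriformOps.star, LinearMap.add_apply, LinearMap.add_apply, LinearMap.add_apply,
      LinearMap.add_apply, isTreeProduct_prec.apply hT hT', isTreeProduct_succ.apply hT hT',
      isTreeProduct_dot.apply hT hT',
      PTree.mstar_eq (PTree.ne_leaf_of_numLeaves hT) (PTree.ne_leaf_of_numLeaves hT')]
    simp [decoratedSum]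

namespace IsTreeProduct

variable {μ μ₁ μ₂ μ₃ μ₄ : PlanarSpace k V →ₗ[k] PlanarSpace k V →ₗ[k] PlanarSpace k V}
  {F F₁ F₂ F₃ F₄ : PTree → PTree → Multiset PTree}

theorem numLeaves_eq (h : IsTreeProduct μ F) {m n : ℕ+} {T T' S : PTree}
    (hT : T.numLeaves = m + 1) (hT' : T'.numLeaves = n + 1) (hS : S ∈ F T T') :
    S.numLeaves = ((m + n : ℕ+) : ℕ) + 1 := by
  have := h.numLeaves (PTree.ne_leaf_of_numLeaves hT) (PTree.ne_leaf_of_numLeaves hT') hS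
  rw [PNat.add_coe]
  omega

theorem sum_left (h : IsTreeProduct μ F) {m n : ℕ+} {s : Multiset PTree} {T : PTree}
    (hs : ∀ S ∈ s, S.numLeaves = m + 1) (hT : T.numLeaves = n + 1)
    (x : ⨂[k]^(m : ℕ) V) (y : ⨂[k]^(n : ℕ) V) :
    μ (decoratedSum s (toTensorAlgebra x)) (decorated T (toTensorAlgebra y)) =
      decoratedSum (s.bind fun S => F S T) (toTensorAlgebra x * toTensorAlgebra y) := by
  induction s using Multiset.induction_on with
  | empty => simp [decoratedSum]
  | cons S s ih =>
    have h1 := ih fun S hS => hs S (Multiset.mem_cons_of_mem hS)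
    have h2 := h.apply (hs S (Multiset.mem_cons_self S s)) hT x y
    simp only [decoratedSum, Multiset.map_cons, Multiset.sum_cons, Multiset.cons_bind,
      Multiset.map_add, Multiset.sum_add, map_add, LinearMap.add_apply] at h1 h2 ⊢
    rw [h1, h2]

theorem sum_right (h : IsTreeProduct μ F) {m n : ℕ+} {s : Multiset PTree} {T : PTree}
    (hT : T.numLeaves = m + 1) (hs : ∀ S ∈ s, S.numLeaves = n + 1)
    (x : ⨂[k]^(m : ℕ) V) (y : ⨂[k]^(n : ℕ) V) :
    μ (decorated T (toTensorAlgebra x)) (decoratedSum s (toTensorAlgebra y)) =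
      decoratedSum (s.bind fun S => F T S) (toTensorAlgebra x * toTensorAlgebra y) := by
  induction s using Multiset.induction_on with
  | empty => simp [decoratedSum]
  | cons S s ih =>
    have h1 := ih fun S hS => hs S (Multiset.mem_cons_of_mem hS)
    have h2 := h.apply hT (hs S (Multiset.mem_cons_self S s)) x y
    simp only [decoratedSum, Multiset.map_cons, Multiset.sum_cons, Multiset.cons_bind,
      Multiset.map_add, Multiset.sum_add, map_add] at h1 h2 ⊢
    rw [h1, h2]

/-- An identity `(x ∘₂ y) ∘₁ z = x ∘₃ (y ∘₄ z)` holds if it holds for trees. -/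
theorem assoc_of_bind (h₁ : IsTreeProduct μ₁ F₁) (h₂ : IsTreeProduct μ₂ F₂)
    (h₃ : IsTreeProduct μ₃ F₃) (h₄ : IsTreeProduct μ₄ F₄)
    (h : ∀ T T' T'' : PTree, T ≠ .leaf → T' ≠ .leaf → T'' ≠ .leaf →
      ((F₂ T T').bind fun S => F₁ S T'') = (F₄ T' T'').bind fun S => F₃ T S)
    (x y z : PlanarSpace k V) : μ₁ (μ₂ x y) z = μ₃ x (μ₄ y z) := by
  -- Both sides are written as trilinear maps so that extensionality reduces the identity to
  -- decorated trees.
  suffices H : μ₂.compr₂ μ₁ = (LinearMap.llcomp k (PlanarSpace k V) (PlanarSpace k V)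
      (PlanarSpace k V) ∘ₗ μ₃).compl₂ μ₄ by
    exact LinearMap.congr_fun (LinearMap.congr_fun (LinearMap.congr_fun H x) y) z
  refine planarSpace_hom_ext fun m T hT x => planarSpace_hom_ext fun n T' hT' y =>
    planarSpace_hom_ext fun p T'' hT'' z => ?_
  change μ₁ (μ₂ _ _) _ = μ₃ _ (μ₄ _ _)
  have hxy : ∀ {m n : ℕ+} (x : ⨂[k]^(m : ℕ) V) (y : ⨂[k]^(n : ℕ) V),
      ∃ w : ⨂[k]^((m + n : ℕ+) : ℕ) V, toTensorAlgebra x * toTensorAlgebra y =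
        toTensorAlgebra w := fun {m n} x y =>
    ⟨TensorPower.cast k V (PNat.add_coe m n).symm (TensorPower.mulEquiv (x ⊗ₜ[k] y)), by
      rw [toTensorAlgebra_cast, toTensorAlgebra_mulEquiv]⟩
  obtain ⟨w, hw⟩ := hxy x y
  obtain ⟨w', hw'⟩ := hxy y z
  rw [h₂.apply hT hT', h₄.apply hT' hT'', hw, hw',
    h₁.sum_left (fun S hS => h₂.numLeaves_eq hT hT' hS) hT'',
    h₃.sum_right hT (fun S hS => h₄.numLeaves_eq hT' hT'' hS), ← hw, ← hw', mul_assoc,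
    h T T' T'' (PTree.ne_leaf_of_numLeaves hT) (PTree.ne_leaf_of_numLeaves hT')
      (PTree.ne_leaf_of_numLeaves hT'')]

end IsTreeProduct

theorem isTridendriform_planarOps : IsTridendriform (planarOps k V) where
  prec_prec := isTreeProduct_prec.assoc_of_bind isTreeProduct_prec isTreeProduct_prec
    isTreeProduct_star fun T T' T'' hT _ _ => by
      cases T with
      | leaf => exact absurd rfl hT
      | node a m b => exact PTree.bind_mprec_mprec (PTree.starAssoc _ _ _)
  succ_prec := isTreeProduct_prec.assoc_of_bind isTreeProduct_succ isTreeProduct_succ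
    isTreeProduct_prec fun T T' T'' _ hT' _ => PTree.bind_msucc_mprec T hT' T''
  succ_succ x y z := (isTreeProduct_succ.assoc_of_bind isTreeProduct_star isTreeProduct_succ
    isTreeProduct_succ (fun T T' T'' _ _ hT'' => by
      cases T'' with
      | leaf => exact absurd rfl hT''
      | node a m b => exact PTree.bind_msucc_msucc (PTree.starAssoc _ _ _)) x y z).symm
  dot_prec := isTreeProduct_prec.assoc_of_bind isTreeProduct_dot isTreeProduct_dot
    isTreeProduct_prec fun T T' T'' hT hT' _ => PTree.bind_mdot_mprec hT hT' T''
  prec_dot := isTreeProduct_dot.assoc_of_bind isTreeProduct_prec isTreeProduct_dot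
    isTreeProduct_succ fun T T' T'' hT _ hT'' => by
      cases T with
      | leaf => exact absurd rfl hT
      | node a m b =>
        cases T'' with
        | leaf => exact absurd rfl hT''
        | node a'' m'' b'' => exact PTree.bind_mprec_mdot (PTree.starAssoc _ _ _)
  succ_dot := isTreeProduct_dot.assoc_of_bind isTreeProduct_succ isTreeProduct_succ
    isTreeProduct_dot fun T T' T'' _ hT' hT'' => PTree.bind_msucc_mdot T hT' hT''
  dot_dot := isTreeProduct_dot.assoc_of_bind isTreeProduct_dot isTreeProduct_dot
    isTreeProduct_dot fun T T' T'' hT hT' hT'' => PTree.bind_mdot_mdot hT hT' hT''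

end Decorated

-- The braiding of the space of decorated trees.

section PlanarBraiding

open TensorPower (toTensorAlgebra)

variable {k : Type*} [Field k] {V : Type*} [AddCommGroup V] [Module k V]

/-- The sum of the trees of a multiset, as a function of their common decoration. -/
def decorate (k V : Type*) [Field k] [AddCommGroup V] [Module k V] (s : Multiset PTree) (n : ℕ) :
    (⨂[k]^n V) →ₗ[k] PlanarSpace k V :=
  (s.map fun S => decorated S ∘ₗ toTensorAlgebra).sum

@[simp] theorem decorate_zero (n : ℕ) : decorate k V 0 n = 0 := by simp [decorate]

theorem decorate_cons (S : PTree) (s : Multiset PTree) (n : ℕ) :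
    decorate k V (S ::ₘ s) n = decorate k V {S} n + decorate k V s n := by simp [decorate]

theorem decorate_singleton (T : PTree) (n : ℕ) (x : ⨂[k]^n V) :
    decorate k V {T} n x = decorated T (toTensorAlgebra x) := by simp [decorate]

theorem decorate_apply (s : Multiset PTree) (n : ℕ) (x : ⨂[k]^n V) :
    decorate k V s n x = decoratedSum s (toTensorAlgebra x) := by
  induction s using Multiset.induction_on with
  | empty => simp [decoratedSum]
  | cons S s ih => simp [decorate_cons, decorate_singleton, ih, decoratedSum]

/-- Fixing the trees and letting the decoration `t` be any tensor, pure or not, allows several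
crossings to be composed. -/
theorem sigmaAT_decorate_singleton (σ : V ⊗[k] V →ₗ[k] V ⊗[k] V) {m n : ℕ} (hm : 0 < m)
    (hn : 0 < n) {T T' : PTree} (hT : T.numLeaves = m + 1) (hT' : T'.numLeaves = n + 1)
    (t : (⨂[k]^m V) ⊗[k] (⨂[k]^n V)) :
    sigmaAT σ (TensorProduct.map (decorate k V {T} m) (decorate k V {T'} n) t) =
      TensorProduct.map (decorate k V {T'} n) (decorate k V {T} m) (beta σ m n t) := by
  lift m to ℕ+ using hm
  lift n to ℕ+ using hn
  have hd : ∀ {n : ℕ+} {T : PTree} (hT : T.numLeaves = n + 1), decorate k V {T} n =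
      ofComponent k V n ∘ₗ (componentEquiv k V n).symm.toLinearMap ∘ₗ
        TensorProduct.mk k (TreeOfDeg n →₀ k) (⨂[k]^(n : ℕ) V) (Finsupp.single ⟨T, hT⟩ 1) :=
    fun hT => LinearMap.ext fun x => by
      rw [decorate_singleton, decorated_toTensorAlgebra hT]
      rfl
  have hmap : ∀ u : (⨂[k]^(n : ℕ) V) ⊗[k] (⨂[k]^(m : ℕ) V),
      TensorProduct.map (decorate k V {T'} n) (decorate k V {T} m) u =
        TensorProduct.map (ofComponent k V n) (ofComponent k V m)
          (TensorProduct.map (componentEquiv k V n).symm.toLinearMap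
            (componentEquiv k V m).symm.toLinearMap
            (TensorProduct.tensorTensorTensorComm k (TreeOfDeg n →₀ k) (TreeOfDeg m →₀ k)
              (⨂[k]^(n : ℕ) V) (⨂[k]^(m : ℕ) V)
              ((Finsupp.single ⟨T', hT'⟩ 1 ⊗ₜ Finsupp.single ⟨T, hT⟩ 1) ⊗ₜ u))) := by
    intro u
    induction u using TensorProduct.induction_on with
    | zero => simp
    | add u v hu hv => simp only [map_add, TensorProduct.tmul_add, hu, hv]
    | tmul x y =>
      rw [hd hT, hd hT']
      rfl
  rw [hmap]
  induction t using TensorProduct.induction_on with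
  | zero => simp
  | add u v hu hv => simp only [map_add, TensorProduct.tmul_add, hu, hv]
  | tmul x y =>
    rw [TensorProduct.map_tmul, sigmaAT, TensorProduct.lift.tmul, decorate_singleton,
      decorate_singleton, decorated_toTensorAlgebra hT, decorated_toTensorAlgebra hT']
    simp only [ofComponent]
    rw [DirectSum.toModule_lof, LinearMap.flip_apply, DirectSum.toModule_lof]
    rfl

theorem sigmaAT_decorate (σ : V ⊗[k] V →ₗ[k] V ⊗[k] V) {m n : ℕ} (hm : 0 < m)
    (hn : 0 < n) {s s' : Multiset PTree} (hs : ∀ S ∈ s, S.numLeaves = m + 1)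
    (hs' : ∀ S ∈ s', S.numLeaves = n + 1) (t : (⨂[k]^m V) ⊗[k] (⨂[k]^n V)) :
    sigmaAT σ (TensorProduct.map (decorate k V s m) (decorate k V s' n) t) =
      TensorProduct.map (decorate k V s' n) (decorate k V s m) (beta σ m n t) := by
  induction s using Multiset.induction_on with
  | empty => simp [TensorProduct.map_zero_left, TensorProduct.map_zero_right]
  | cons S s ih =>
    rw [decorate_cons, TensorProduct.map_add_left, TensorProduct.map_add_right,
      LinearMap.add_apply, LinearMap.add_apply, map_add,
      ih fun S hS => hs S (Multiset.mem_cons_of_mem hS)]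
    congr 1
    have hS := hs S (Multiset.mem_cons_self S s)
    clear ih hs
    induction s' using Multiset.induction_on with
    | empty => simp [TensorProduct.map_zero_left, TensorProduct.map_zero_right]
    | cons S' s' ih =>
      rw [decorate_cons, TensorProduct.map_add_left, TensorProduct.map_add_right,
        LinearMap.add_apply, LinearMap.add_apply, map_add,
        ih fun S hS => hs' S (Multiset.mem_cons_of_mem hS),
        sigmaAT_decorate_singleton σ hm hn hS (hs' S' (Multiset.mem_cons_self _ _))]

/-- Three decorated trees, as a function of their decorations. -/
def decorate₃ (k V : Type*) [Field k] [AddCommGroup V] [Module k V] (T T' T'' : PTree)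
    (m n p : ℕ) : ((⨂[k]^m V) ⊗[k] (⨂[k]^n V)) ⊗[k] (⨂[k]^p V) →ₗ[k]
      (PlanarSpace k V ⊗[k] PlanarSpace k V) ⊗[k] PlanarSpace k V :=
  TensorProduct.map (TensorProduct.map (decorate k V {T} m) (decorate k V {T'} n))
    (decorate k V {T''} p)

theorem planarSpace_trilin_ext {X : Type*} [AddCommMonoid X] [Module k X]
    {f g : (PlanarSpace k V ⊗[k] PlanarSpace k V) ⊗[k] PlanarSpace k V →ₗ[k] X}
    (h : ∀ (m n p : ℕ) (T T' T'' : PTree), 0 < m → 0 < n → 0 < p → T.numLeaves = m + 1 →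
      T'.numLeaves = n + 1 → T''.numLeaves = p + 1 →
      ∀ t, f (decorate₃ k V T T' T'' m n p t) = g (decorate₃ k V T T' T'' m n p t)) : f = g := by
  refine TensorProduct.ext (TensorProduct.ext (planarSpace_hom_ext fun m T hT x =>
    planarSpace_hom_ext fun n T' hT' y => planarSpace_hom_ext fun p T'' hT'' z => ?_))
  simpa [decorate₃, decorate_singleton] using
    h m n p T T' T'' m.pos n.pos p.pos hT hT' hT'' ((x ⊗ₜ y) ⊗ₜ z)

theorem sigmaOne_sigmaAT_decorate₃ (σ : V ⊗[k] V →ₗ[k] V ⊗[k] V) {m n p : ℕ} (hm : 0 < m)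
    (hn : 0 < n) {T T' : PTree} (T'' : PTree) (hT : T.numLeaves = m + 1)
    (hT' : T'.numLeaves = n + 1) (t : ((⨂[k]^m V) ⊗[k] (⨂[k]^n V)) ⊗[k] (⨂[k]^p V)) :
    sigmaOne (sigmaAT σ) (decorate₃ k V T T' T'' m n p t) =
      decorate₃ k V T' T T'' n m p (betaOne σ m n p t) := by
  induction t using TensorProduct.induction_on with
  | zero => simp
  | add u v hu hv => simp only [map_add, hu, hv]
  | tmul u z =>
    simp only [sigmaOne, decorate₃, betaOne, TensorProduct.map_tmul, LinearMap.rTensor_tmul]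
    rw [sigmaAT_decorate_singleton σ hm hn hT hT']

theorem sigmaTwo_sigmaAT_decorate₃ (σ : V ⊗[k] V →ₗ[k] V ⊗[k] V) {m n p : ℕ} (hn : 0 < n)
    (hp : 0 < p) (T : PTree) {T' T'' : PTree} (hT' : T'.numLeaves = n + 1)
    (hT'' : T''.numLeaves = p + 1) (t : ((⨂[k]^m V) ⊗[k] (⨂[k]^n V)) ⊗[k] (⨂[k]^p V)) :
    sigmaTwo (sigmaAT σ) (decorate₃ k V T T' T'' m n p t) =
      decorate₃ k V T T'' T' m p n (betaTwo σ m n p t) := by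
  obtain ⟨s, rfl⟩ := (TensorProduct.assoc k _ _ _).symm.surjective t
  have h : ∀ {n p : ℕ} {T' T'' : PTree} (s : (⨂[k]^m V) ⊗[k] ((⨂[k]^n V) ⊗[k] (⨂[k]^p V))),
      decorate₃ k V T T' T'' m n p ((TensorProduct.assoc k _ _ _).symm s) =
        (TensorProduct.assoc k _ _ _).symm (TensorProduct.map (decorate k V {T} m)
          (TensorProduct.map (decorate k V {T'} n) (decorate k V {T''} p)) s) := by
    intro n p T' T'' s
    exact LinearMap.congr_fun (TensorProduct.map_map_comp_assoc_symm_eq _ _ _) s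
  rw [h, sigmaTwo, betaTwo]
  simp only [LinearMap.comp_apply, LinearEquiv.coe_coe, LinearEquiv.apply_symm_apply, h]
  congr 1
  induction s using TensorProduct.induction_on with
  | zero => simp
  | add u v hu hv => simp only [map_add, hu, hv]
  | tmul x u =>
    simp only [TensorProduct.map_tmul, LinearMap.lTensor_tmul]
    rw [sigmaAT_decorate_singleton σ hn hp hT' hT'']

/-- Both sides reverse the order of the three trees, so only the relation for β on the decorations
remains. -/
theorem isBraiding_sigmaAT {σ : V ⊗[k] V →ₗ[k] V ⊗[k] V} (hσ : IsBraiding σ) :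
    IsBraiding (sigmaAT σ) := by
  rw [IsBraiding]
  apply planarSpace_trilin_ext
  intro m n p T T' T'' hm hn hp hT hT' hT'' t
  simp only [LinearMap.comp_apply]
  rw [sigmaOne_sigmaAT_decorate₃ σ hm hn T'' hT hT', sigmaTwo_sigmaAT_decorate₃ σ hm hp T' hT hT'',
    sigmaOne_sigmaAT_decorate₃ σ hn hp T hT' hT'', sigmaTwo_sigmaAT_decorate₃ σ hn hp T hT' hT'',
    sigmaOne_sigmaAT_decorate₃ σ hm hp T' hT hT'', sigmaTwo_sigmaAT_decorate₃ σ hm hn T'' hT hT']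
  congr 1
  exact LinearMap.congr_fun (beta_yangBaxter hσ m n p) t

namespace IsTreeProduct

variable {μ : PlanarSpace k V →ₗ[k] PlanarSpace k V →ₗ[k] PlanarSpace k V}
  {F : PTree → PTree → Multiset PTree}

theorem lift_comp_map (h : IsTreeProduct μ F) {m n : ℕ} (hm : 0 < m) (hn : 0 < n) {T T' : PTree}
    (hT : T.numLeaves = m + 1) (hT' : T'.numLeaves = n + 1) :
    TensorProduct.lift μ ∘ₗ TensorProduct.map (decorate k V {T} m) (decorate k V {T'} n) =
      decorate k V (F T T') (m + n) ∘ₗ TensorPower.mulEquiv.toLinearMap := by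
  lift m to ℕ+ using hm
  lift n to ℕ+ using hn
  refine TensorProduct.ext' fun x y => ?_
  simp only [LinearMap.comp_apply, TensorProduct.map_tmul, TensorProduct.lift.tmul,
    decorate_singleton, h.apply hT hT', LinearEquiv.coe_coe]
  rw [decorate_apply, toTensorAlgebra_mulEquiv]

theorem rTensor_lift_decorate₃ (h : IsTreeProduct μ F) {m n p : ℕ} (hm : 0 < m) (hn : 0 < n)
    {T T' : PTree} (T'' : PTree) (hT : T.numLeaves = m + 1) (hT' : T'.numLeaves = n + 1)
    (t : ((⨂[k]^m V) ⊗[k] (⨂[k]^n V)) ⊗[k] (⨂[k]^p V)) :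
    LinearMap.rTensor _ (TensorProduct.lift μ) (decorate₃ k V T T' T'' m n p t) =
      TensorProduct.map (decorate k V (F T T') (m + n)) (decorate k V {T''} p)
        (LinearMap.rTensor _ TensorPower.mulEquiv.toLinearMap t) := by
  rw [decorate₃, ← LinearMap.comp_apply, ← LinearMap.comp_apply, LinearMap.rTensor_comp_map,
    LinearMap.map_comp_rTensor, h.lift_comp_map hm hn hT hT']

theorem lTensor_lift_decorate₃ (h : IsTreeProduct μ F) {m n p : ℕ} (hn : 0 < n) (hp : 0 < p)
    (T : PTree) {T' T'' : PTree} (hT' : T'.numLeaves = n + 1) (hT'' : T''.numLeaves = p + 1)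
    (t : ((⨂[k]^m V) ⊗[k] (⨂[k]^n V)) ⊗[k] (⨂[k]^p V)) :
    LinearMap.lTensor _ (TensorProduct.lift μ)
        (TensorProduct.assoc k _ _ _ (decorate₃ k V T T' T'' m n p t)) =
      TensorProduct.map (decorate k V {T} m) (decorate k V (F T' T'') (n + p))
        (LinearMap.lTensor _ TensorPower.mulEquiv.toLinearMap (TensorProduct.assoc k _ _ _ t)) := by
  have : TensorProduct.assoc k _ _ _ (decorate₃ k V T T' T'' m n p t) =
      TensorProduct.map (decorate k V {T} m)
        (TensorProduct.map (decorate k V {T'} n) (decorate k V {T''} p))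
        (TensorProduct.assoc k _ _ _ t) :=
    LinearMap.congr_fun (TensorProduct.map_map_comp_assoc_eq _ _ _).symm t
  rw [this, ← LinearMap.comp_apply, ← LinearMap.comp_apply, LinearMap.lTensor_comp_map,
    LinearMap.map_comp_lTensor, h.lift_comp_map hn hp hT' hT'']

/-- The rule `F` for multiplying trees plays no role beyond its degrees: decorations are
concatenated, and the two compatibilities are `beta_mul_right` and `beta_mul_left`. -/
theorem isBraidedProduct (h : IsTreeProduct μ F) (σ : V ⊗[k] V →ₗ[k] V ⊗[k] V) :
    IsBraidedProduct μ (sigmaAT σ) := by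
  have hF : ∀ {m n : ℕ} {T T' : PTree}, 0 < m → 0 < n → T.numLeaves = m + 1 →
      T'.numLeaves = n + 1 → ∀ S ∈ F T T', S.numLeaves = m + n + 1 := by
    intro m n T T' hm hn hT hT' S hS
    lift m to ℕ+ using hm
    lift n to ℕ+ using hn
    exact h.numLeaves_eq hT hT' hS
  refine ⟨planarSpace_trilin_ext fun m n p T T' T'' hm hn hp hT hT' hT'' t => ?_,
    planarSpace_trilin_ext fun m n p T T' T'' hm hn hp hT hT' hT'' t => ?_⟩
  · simp only [LinearMap.comp_apply, LinearEquiv.coe_coe]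
    rw [h.lTensor_lift_decorate₃ hn hp T hT' hT'',
      sigmaAT_decorate σ hm (by omega) (by simpa using hT) (hF hn hp hT' hT''), beta_mul_right,
      sigmaOne_sigmaAT_decorate₃ σ hm hn T'' hT hT',
      sigmaTwo_sigmaAT_decorate₃ σ hm hp T' hT hT'', h.rTensor_lift_decorate₃ hn hp T hT' hT'']
  · simp only [LinearMap.comp_apply, LinearEquiv.coe_coe]
    rw [h.rTensor_lift_decorate₃ hm hn T'' hT hT',
      sigmaAT_decorate σ (by omega) hp (hF hm hn hT hT') (by simpa using hT''), beta_mul_left,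
      sigmaTwo_sigmaAT_decorate₃ σ hn hp T hT' hT'',
      sigmaOne_sigmaAT_decorate₃ σ hm hp T' hT hT'', h.lTensor_lift_decorate₃ hm hn T'' hT hT']

end IsTreeProduct

theorem isBraidedTridendriform_planarOps {σ : V ⊗[k] V →ₗ[k] V ⊗[k] V} (hσ : IsBraiding σ) :
    IsBraidedTridendriform (planarOps k V) (sigmaAT σ) where
  braiding := isBraiding_sigmaAT hσ
  tridendriform := isTridendriform_planarOps
  prec_compat := isTreeProduct_prec.isBraidedProduct σ
  succ_compat := isTreeProduct_succ.isBraidedProduct σ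
  dot_compat := isTreeProduct_dot.isBraidedProduct σ

theorem planarIncl_apply (v : V) :
    planarIncl k V v = decorated (.node .leaf [] .leaf) (TensorAlgebra.ι k v) := by
  have h1 : TensorAlgebra.ι k v = toTensorAlgebra
      (TensorPower.cast k V PNat.one_coe.symm (PiTensorProduct.tprod k fun _ : Fin 1 => v)) := by
    rw [toTensorAlgebra_cast, toTensorAlgebra_tprod_eq_tensorWord]
    simp [tensorWord]
  rw [h1, decorated_toTensorAlgebra (n := 1) (by simp [PTree.numLeaves, PTree.numLeavesList])]
  simp only [planarIncl, LinearMap.comp_apply, LinearEquiv.coe_coe]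
  rw [PiTensorProduct.subsingletonEquiv_symm_apply']
  rfl

/-- The word of χ_{1,1} is the single letter 0, so β_{1,1} is σ itself. -/
theorem isBraidedMap_planarIncl (σ : V ⊗[k] V →ₗ[k] V ⊗[k] V) :
    IsBraidedMap σ (sigmaAT σ) (planarIncl k V) := by
  let u : V →ₗ[k] ⨂[k]^1 V :=
    (PiTensorProduct.subsingletonEquiv (R := k) (s := fun _ : Fin 1 => V)
      (0 : Fin 1)).symm.toLinearMap
  have hu : ∀ v, toTensorAlgebra (u v) = TensorAlgebra.ι k v := by
    intro v
    simp only [u, LinearEquiv.coe_coe]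
    rw [PiTensorProduct.subsingletonEquiv_symm_apply, toTensorAlgebra_tprod_eq_tensorWord]
    simp [tensorWord]
  have hincl : planarIncl k V = decorate k V {.node .leaf [] .leaf} 1 ∘ₗ u := by
    ext v
    rw [planarIncl_apply, LinearMap.comp_apply, decorate_singleton, hu]
  have hmul : ∀ t : V ⊗[k] V, mulTA k V 1 1 (TensorProduct.map u u t) = pairTA k V t := by
    intro t
    induction t using TensorProduct.induction_on with
    | zero => simp
    | add x y hx hy => simp only [map_add, hx, hy]
    | tmul x y => simp [hu]
  have hβ : ∀ t : V ⊗[k] V,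
      beta σ 1 1 (TensorProduct.map u u t) = TensorProduct.map u u (σ t) := by
    intro t
    apply mulTA_injective
    rw [mulTA_beta, hmul, hmul]
    have := sigmaTA_mul_pair_mul σ [] [] t
    simpa [chiWord, wordTA] using this
  refine LinearMap.ext fun t => ?_
  rw [LinearMap.comp_apply, LinearMap.comp_apply, hincl, TensorProduct.map_comp,
    LinearMap.comp_apply, LinearMap.comp_apply,
    sigmaAT_decorate_singleton σ one_pos one_pos
      (by simp [PTree.numLeaves, PTree.numLeavesList])
      (by simp [PTree.numLeaves, PTree.numLeavesList]), hβ]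

end PlanarBraiding

-- Generation by V.

section Generation

open TensorPower (toTensorAlgebra)

variable {k : Type*} [Field k] {V : Type*} [AddCommGroup V] [Module k V]

theorem planarSpace_hom_ext_word {X : Type*} [AddCommMonoid X] [Module k X]
    {f g : PlanarSpace k V →ₗ[k] X}
    (h : ∀ (T : PTree) (l : List V), T ≠ .leaf → T.numLeaves = l.length + 1 →
      f (decorated T (tensorWord k l)) = g (decorated T (tensorWord k l))) : f = g := by
  refine planarSpace_hom_ext fun n T hT x => ?_
  refine tensorPower_induction (n := n) (P := fun x => f (decorated T x) = g (decorated T x))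
    (fun x y hx hy => by simp only [map_add, hx, hy]) (fun c x hx => by simp only [map_smul, hx])
    (fun l hl => h T l (PTree.ne_leaf_of_numLeaves hT) (by omega)) x

theorem IsTreeProduct.apply_word {μ : PlanarSpace k V →ₗ[k] PlanarSpace k V →ₗ[k] PlanarSpace k V}
    {F : PTree → PTree → Multiset PTree} (h : IsTreeProduct μ F) {T T' : PTree} {l l' : List V}
    (hT : T ≠ .leaf) (hT' : T' ≠ .leaf) (hl : T.numLeaves = l.length + 1)
    (hl' : T'.numLeaves = l'.length + 1) :
    μ (decorated T (tensorWord k l)) (decorated T' (tensorWord k l')) =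
      decoratedSum (F T T') (tensorWord k (l ++ l')) := by
  have h1 := PTree.one_lt_numLeaves hT
  have h2 := PTree.one_lt_numLeaves hT'
  rw [tensorWord_append, tensorWord_eq_toTensorAlgebra, tensorWord_eq_toTensorAlgebra l']
  exact h.apply (m := ⟨l.length, by omega⟩) (n := ⟨l'.length, by omega⟩) hl hl' _ _

/-- `PlanarSpace k V` is generated by `V`, for the three products. -/
theorem eq_top_of_planarIncl_mem (S : Submodule k (PlanarSpace k V))
    (hV : ∀ v, planarIncl k V v ∈ S)
    (hprec : ∀ x ∈ S, ∀ y ∈ S, (planarOps k V).prec x y ∈ S)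
    (hsucc : ∀ x ∈ S, ∀ y ∈ S, (planarOps k V).succ x y ∈ S)
    (hdot : ∀ x ∈ S, ∀ y ∈ S, (planarOps k V).dot x y ∈ S) : S = ⊤ := by
  have key : ∀ (n : ℕ) (T : PTree) (l : List V), T ≠ .leaf → T.numLeaves = n →
      T.numLeaves = l.length + 1 → decorated T (tensorWord k l) ∈ S := by
    intro n
    induction n using Nat.strong_induction_on with
    | _ n ih =>
    intro T l hT hn hl
    cases T with
    | leaf => exact absurd rfl hT
    | node a m b =>
      have ha := a.numLeaves_pos
      have hb := b.numLeaves_pos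
      simp only [PTree.numLeaves] at hl hn
      -- Peel the root. If `a` is not the leaf, the tree is a ≻ (| ∨ m ∨ b). Otherwise a middle
      -- branch t gives (| ∨ t) · (| ∨ ts ∨ b). With only two branches, it is (| ∨ |) ≺ b, or a
      -- generator when `b` is the leaf.
      by_cases h : a = .leaf
      · subst h
        cases m with
        | nil =>
          simp only [PTree.numLeaves, PTree.numLeavesList] at hl hn
          obtain ⟨v, l, rfl⟩ := List.exists_cons_of_length_pos (l := l) (by omega)
          simp only [List.length_cons] at hl
          by_cases h : b = .leaf
          · subst h
            simp only [PTree.numLeaves] at hl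
            obtain rfl : l = [] := List.length_eq_zero_iff.mp (by omega)
            have := hV v
            rw [planarIncl_apply] at this
            simpa [tensorWord] using this
          · have h1 := isTreeProduct_prec.apply_word (k := k) (T := .node .leaf [] .leaf)
              (l := [v]) (l' := l) (by simp) h (by simp [PTree.numLeaves, PTree.numLeavesList])
              (by omega)
            rw [PTree.mprec_node, PTree.mstar_leaf_left, Multiset.map_singleton] at h1
            simp only [decoratedSum, Multiset.map_singleton, Multiset.sum_singleton,
              List.singleton_append] at h1
            have h2 := PTree.one_lt_numLeaves h
            rw [← h1]
            exact hprec _ (ih 2 (by omega) _ _ (by simp)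
              (by simp [PTree.numLeaves, PTree.numLeavesList])
              (by simp [PTree.numLeaves, PTree.numLeavesList])) _
              (ih _ (by omega) _ _ h rfl (by omega))
        | cons t ts =>
          simp only [PTree.numLeaves, PTree.numLeavesList] at hl hn
          have ht := t.numLeaves_pos
          -- The first factor | ∨ t has one angle at the root and `t.numLeaves - 1` inside `t`.
          obtain ⟨p, q, rfl, hp⟩ : ∃ p q, l = p ++ q ∧ p.length = t.numLeaves :=
            ⟨l.take t.numLeaves, l.drop t.numLeaves, by simp, by simp; omega⟩
          simp only [List.length_append] at hl
          have n1 : (PTree.node .leaf [] t).numLeaves = t.numLeaves + 1 := by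
            simp only [PTree.numLeaves, PTree.numLeavesList]; omega
          have n2 : (PTree.node .leaf ts b).numLeaves =
              1 + PTree.numLeavesList ts + b.numLeaves := by
            simp only [PTree.numLeaves]
          have h1 := isTreeProduct_dot.apply_word (k := k) (T := .node .leaf [] t)
            (T' := .node .leaf ts b) (l := p) (l' := q) (by simp) (by simp) (by omega) (by omega)
          rw [PTree.mdot_node, PTree.mstar_leaf_right, Multiset.map_singleton] at h1
          simp only [decoratedSum, Multiset.map_singleton, Multiset.sum_singleton,
            List.nil_append] at h1
          rw [← h1]
          exact hdot _ (ih _ (by omega) _ _ (by simp) rfl (by omega)) _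
            (ih _ (by omega) _ _ (by simp) rfl (by omega))
      · have h2 := PTree.one_lt_numLeaves h
        obtain ⟨p, q, rfl, hp⟩ : ∃ p q, l = p ++ q ∧ p.length = a.numLeaves - 1 :=
          ⟨l.take (a.numLeaves - 1), l.drop (a.numLeaves - 1), by simp, by simp; omega⟩
        simp only [List.length_append] at hl
        have n2 : (PTree.node .leaf m b).numLeaves = 1 + PTree.numLeavesList m + b.numLeaves := by
          simp only [PTree.numLeaves]
        have h1 := isTreeProduct_succ.apply_word (k := k) (T := a)
          (T' := .node .leaf m b) (l := p) (l' := q) h (by simp) (by omega) (by omega)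
        rw [PTree.msucc_node, PTree.mstar_leaf_right, Multiset.map_singleton] at h1
        simp only [decoratedSum, Multiset.map_singleton, Multiset.sum_singleton] at h1
        rw [← h1]
        exact hsucc _ (ih _ (by omega) _ _ h rfl (by omega)) _
          (ih _ (by omega) _ _ (by simp) rfl (by omega))
  have hq : S.mkQ = 0 := planarSpace_hom_ext_word fun T l hT hl => by
    simpa using key _ T l hT rfl hl
  rw [← Submodule.ker_mkQ S, hq, LinearMap.ker_zero]

end Generation

-- Braidedness is inherited from generators.

section BraidedHom

variable {k : Type*} [Field k] {V P R : Type*} [AddCommGroup V] [Module k V] [AddCommGroup P]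
  [Module k P] [AddCommGroup R] [Module k R]

section Products

variable {μ : P →ₗ[k] P →ₗ[k] P} {ν : R →ₗ[k] R →ₗ[k] R} {σ : P ⊗[k] P →ₗ[k] P ⊗[k] P}
  {τ : R ⊗[k] R →ₗ[k] R ⊗[k] R} {ψ : P →ₗ[k] R}

/-- In (id ⊗ μ) σ₁ σ₂ the element `b` crosses `y`, then `a` crosses whatever comes out. The
hypotheses allow any right-hand entry, so they apply to both crossings. -/
theorem braided_apply_product_left (hμ : IsBraidedProduct μ σ) (hν : IsBraidedProduct ν τ)
    (hψ : ∀ x y, ψ (μ x y) = ν (ψ x) (ψ y)) {a b : P}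
    (ha : ∀ y, TensorProduct.map ψ ψ (σ (a ⊗ₜ y)) = τ (ψ a ⊗ₜ ψ y))
    (hb : ∀ y, TensorProduct.map ψ ψ (σ (b ⊗ₜ y)) = τ (ψ b ⊗ₜ ψ y)) (y : P) :
    TensorProduct.map ψ ψ (σ (μ a b ⊗ₜ y)) = τ (ψ (μ a b) ⊗ₜ ψ y) := by
  have h1 := LinearMap.congr_fun hμ.2 ((a ⊗ₜ b) ⊗ₜ y)
  have h2 := LinearMap.congr_fun hν.2 ((ψ a ⊗ₜ ψ b) ⊗ₜ ψ y)
  simp only [LinearMap.comp_apply, LinearMap.rTensor_tmul, TensorProduct.lift.tmul, sigmaTwo,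
    LinearEquiv.coe_coe, TensorProduct.assoc_tmul, LinearMap.lTensor_tmul] at h1 h2
  rw [hψ, h1, h2, ← hb]
  generalize σ (b ⊗ₜ y) = t
  induction t using TensorProduct.induction_on with
  | zero => simp
  | add u v hu hv => simp only [map_add, TensorProduct.tmul_add, hu, hv]
  | tmul u w =>
    simp only [TensorProduct.assoc_symm_tmul, sigmaOne, LinearMap.rTensor_tmul,
      TensorProduct.map_tmul, ← ha]
    generalize σ (a ⊗ₜ u) = s
    induction s using TensorProduct.induction_on with
    | zero => simp
    | add u v hu hv => simp only [map_add, TensorProduct.add_tmul, hu, hv]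
    | tmul p q => simp [hψ]

variable {ι : V →ₗ[k] P}

/-- After ι v has crossed `a`, the element that goes on to cross `b` must again lie in the image of
ι for the hypothesis on `b` to apply. The range condition guarantees this and is carried through the
induction. -/
theorem braided_apply_product_right (hμ : IsBraidedProduct μ σ) (hν : IsBraidedProduct ν τ)
    (hψ : ∀ x y, ψ (μ x y) = ν (ψ x) (ψ y)) {a b : P}
    (ha : ∀ v, TensorProduct.map ψ ψ (σ (ι v ⊗ₜ a)) = τ (ψ (ι v) ⊗ₜ ψ a) ∧
      σ (ι v ⊗ₜ a) ∈ LinearMap.range (LinearMap.lTensor P ι))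
    (hb : ∀ v, TensorProduct.map ψ ψ (σ (ι v ⊗ₜ b)) = τ (ψ (ι v) ⊗ₜ ψ b) ∧
      σ (ι v ⊗ₜ b) ∈ LinearMap.range (LinearMap.lTensor P ι)) (v : V) :
    TensorProduct.map ψ ψ (σ (ι v ⊗ₜ μ a b)) = τ (ψ (ι v) ⊗ₜ ψ (μ a b)) ∧
      σ (ι v ⊗ₜ μ a b) ∈ LinearMap.range (LinearMap.lTensor P ι) := by
  have h1 := LinearMap.congr_fun hμ.1 ((ι v ⊗ₜ a) ⊗ₜ b)
  have h2 := LinearMap.congr_fun hν.1 ((ψ (ι v) ⊗ₜ ψ a) ⊗ₜ ψ b)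
  simp only [LinearMap.comp_apply, LinearMap.lTensor_tmul, TensorProduct.lift.tmul, sigmaOne,
    LinearEquiv.coe_coe, TensorProduct.assoc_tmul, LinearMap.rTensor_tmul] at h1 h2
  obtain ⟨s, hs⟩ := (ha v).2
  rw [hψ, h1, h2, ← (ha v).1, ← hs]
  clear hs h1 h2
  induction s using TensorProduct.induction_on with
  | zero => simp
  | add u v hu hv =>
    simp only [map_add, TensorProduct.add_tmul, hu.1, hv.1, true_and]
    exact Submodule.add_mem _ hu.2 hv.2
  | tmul u w =>
    simp only [TensorProduct.assoc_tmul, sigmaTwo, LinearMap.comp_apply, LinearEquiv.coe_coe,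
      LinearMap.lTensor_tmul, TensorProduct.map_tmul, ← (hb w).1]
    obtain ⟨s, hs⟩ := (hb w).2
    rw [← hs]
    clear hs
    induction s using TensorProduct.induction_on with
    | zero => simp
    | add u v hu hv =>
      simp only [map_add, TensorProduct.tmul_add, hu.1, hv.1, true_and]
      exact Submodule.add_mem _ hu.2 hv.2
    | tmul p q =>
      refine ⟨by simp [hψ], μ u p ⊗ₜ q, by simp⟩

end Products

/-- A homomorphism of tridendriform algebras is braided if it is so on generators. -/
theorem isBraidedMap_of_generators {D : TridendriformOps k P} {E : TridendriformOps k R}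
    {σ : V ⊗[k] V →ₗ[k] V ⊗[k] V} {σ' : P ⊗[k] P →ₗ[k] P ⊗[k] P} {τ : R ⊗[k] R →ₗ[k] R ⊗[k] R}
    (hD : IsBraidedTridendriform D σ') (hE : IsBraidedTridendriform E τ) {ι : V →ₗ[k] P}
    (hgen : ∀ S : Submodule k P, (∀ v, ι v ∈ S) → (∀ x ∈ S, ∀ y ∈ S, D.prec x y ∈ S) →
      (∀ x ∈ S, ∀ y ∈ S, D.succ x y ∈ S) → (∀ x ∈ S, ∀ y ∈ S, D.dot x y ∈ S) → S = ⊤)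
    (hι : IsBraidedMap σ σ' ι) {ψ : P →ₗ[k] R} (hψ : IsBraidedMap σ τ (ψ ∘ₗ ι))
    (hprec : ∀ x y, ψ (D.prec x y) = E.prec (ψ x) (ψ y))
    (hsucc : ∀ x y, ψ (D.succ x y) = E.succ (ψ x) (ψ y))
    (hdot : ∀ x y, ψ (D.dot x y) = E.dot (ψ x) (ψ y)) : IsBraidedMap σ' τ ψ := by
  -- First stage: a generator on the left against an arbitrary element on the right.
  let B : Submodule k P :=
    { carrier := {y | ∀ v, TensorProduct.map ψ ψ (σ' (ι v ⊗ₜ y)) = τ (ψ (ι v) ⊗ₜ ψ y) ∧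
        σ' (ι v ⊗ₜ y) ∈ LinearMap.range (LinearMap.lTensor P ι)}
      add_mem' := fun {x y} hx hy v => by
        simp only [TensorProduct.tmul_add, map_add, (hx v).1, (hy v).1, true_and]
        exact Submodule.add_mem _ (hx v).2 (hy v).2
      zero_mem' := fun v => by simp
      smul_mem' := fun c x hx v => by
        simp only [TensorProduct.tmul_smul, map_smul, (hx v).1, true_and]
        exact Submodule.smul_mem _ _ (hx v).2 }
  have hB : B = ⊤ := by
    refine hgen B (fun w v => ?_)
      (fun x hx y hy => braided_apply_product_right hD.prec_compat hE.prec_compat hprec hx hy)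
      (fun x hx y hy => braided_apply_product_right hD.succ_compat hE.succ_compat hsucc hx hy)
      (fun x hx y hy => braided_apply_product_right hD.dot_compat hE.dot_compat hdot hx hy)
    have h1 : σ' (ι v ⊗ₜ ι w) = TensorProduct.map ι ι (σ (v ⊗ₜ w)) :=
      (LinearMap.congr_fun hι (v ⊗ₜ w)).symm
    have h2 := LinearMap.congr_fun hψ (v ⊗ₜ w)
    rw [TensorProduct.map_comp] at h2
    refine ⟨by rw [h1]; exact h2, ?_⟩
    rw [h1]
    refine ⟨LinearMap.rTensor V ι (σ (v ⊗ₜ w)), ?_⟩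
    rw [← LinearMap.comp_apply, LinearMap.lTensor_comp_rTensor]
  -- Second stage: arbitrary elements on both sides, the first stage being the case of generators.
  let A : Submodule k P :=
    { carrier := {x | ∀ y, TensorProduct.map ψ ψ (σ' (x ⊗ₜ y)) = τ (ψ x ⊗ₜ ψ y)}
      add_mem' := fun {x y} hx hy z => by
        simp only [TensorProduct.add_tmul, map_add, hx z, hy z]
      zero_mem' := fun v => by simp
      smul_mem' := fun c x hx v => by
        simp only [← TensorProduct.smul_tmul', map_smul, hx v] }
  have hA : A = ⊤ := by
    refine hgen A (fun v y => ?_)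
      (fun x hx y hy => braided_apply_product_left hD.prec_compat hE.prec_compat hprec hx hy)
      (fun x hx y hy => braided_apply_product_left hD.succ_compat hE.succ_compat hsucc hx hy)
      (fun x hx y hy => braided_apply_product_left hD.dot_compat hE.dot_compat hdot hx hy)
    have hy : y ∈ B := hB ▸ Submodule.mem_top
    exact (hy v).1
  refine TensorProduct.ext' fun x y => ?_
  have hx : x ∈ A := hA ▸ Submodule.mem_top
  exact hx y

end BraidedHom

-- Adjoining a unit, the future value of the leaf.

section Unital

variable {k : Type*} [Field k] {R : Type*} [AddCommGroup R] [Module k R]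

namespace TridendriformOps

variable (D : TridendriformOps k R)

/-- The extension of `≺` to a right action of `k ⊕ R`. -/
def precU : R →ₗ[k] (k × R) →ₗ[k] R :=
  (LinearMap.lsmul k R).flip.compl₂ (LinearMap.fst k k R) +
    D.prec.compl₂ (LinearMap.snd k k R)

/-- The extension of `≻` to a left action of `k ⊕ R`. -/
def succU : (k × R) →ₗ[k] R →ₗ[k] R :=
  LinearMap.lsmul k R ∘ₗ LinearMap.fst k k R + D.succ ∘ₗ LinearMap.snd k k R

/-- The product of `k ⊕ R`, where `R` carries the product `*`. -/
def starU (p q : k × R) : k × R :=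
  (p.1 * q.1, p.1 • q.2 + q.1 • p.2 + D.star p.2 q.2)

theorem precU_apply (x : R) (p : k × R) : D.precU x p = p.1 • x + D.prec x p.2 := rfl

theorem succU_apply (p : k × R) (x : R) : D.succU p x = p.1 • x + D.succ p.2 x := rfl

@[simp] theorem precU_one (x : R) : D.precU x (1, 0) = x := by simp [precU_apply]

@[simp] theorem succU_one (x : R) : D.succU (1, 0) x = x := by simp [succU_apply]

@[simp] theorem precU_zero_left (x y : R) : D.precU x (0, y) = D.prec x y := by
  simp [precU_apply]

@[simp] theorem succU_zero_left (x y : R) : D.succU (0, x) y = D.succ x y := by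
  simp [succU_apply]

theorem starU_one_left (p : k × R) : D.starU (1, 0) p = p := by simp [starU]

theorem starU_one_right (p : k × R) : D.starU p (1, 0) = p := by simp [starU]

variable {D}

/-- With the unit adjoined, the axioms without the dot say that k ⊕ R with `*` acts on R from the
right by ≺ and from the left by ≻, and that these actions commute. -/
theorem precU_precU (hD : IsTridendriform D) (x : R) (p q : k × R) :
    D.precU (D.precU x p) q = D.precU x (D.starU p q) := by
  simp only [precU_apply, starU, map_add, map_smul, LinearMap.add_apply, LinearMap.smul_apply,
    hD.prec_prec]
  module

theorem succU_succU (hD : IsTridendriform D) (p q : k × R) (x : R) :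
    D.succU p (D.succU q x) = D.succU (D.starU p q) x := by
  simp only [succU_apply, starU, map_add, map_smul, LinearMap.add_apply, LinearMap.smul_apply,
    hD.succ_succ]
  module

theorem precU_succU (hD : IsTridendriform D) (p : k × R) (x : R) (q : k × R) :
    D.precU (D.succU p x) q = D.succU p (D.precU x q) := by
  simp only [succU_apply, precU_apply, map_add, map_smul, LinearMap.add_apply,
    LinearMap.smul_apply, hD.succ_prec]
  module

theorem dot_precU (hD : IsTridendriform D) (x : R) (p : k × R) (y : R) :
    D.dot (D.precU x p) y = D.dot x (D.succU p y) := by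
  simp only [succU_apply, precU_apply, map_add, map_smul, LinearMap.add_apply,
    LinearMap.smul_apply, hD.prec_dot]

theorem precU_dot (hD : IsTridendriform D) (x y : R) (p : k × R) :
    D.precU (D.dot x y) p = D.dot x (D.precU y p) := by
  simp only [precU_apply, map_add, map_smul, hD.dot_prec]

theorem succU_dot (hD : IsTridendriform D) (p : k × R) (x y : R) :
    D.succU p (D.dot x y) = D.dot (D.succU p x) y := by
  simp only [succU_apply, map_add, map_smul, LinearMap.add_apply, LinearMap.smul_apply,
    hD.succ_dot]

end TridendriformOps

end Unital

-- Evaluating decorated trees in a tridendriform algebra.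

section Evaluation

variable {k : Type*} [Field k] {V R : Type*} [AddCommGroup V] [Module k V] [AddCommGroup R]
  [Module k R]

mutual
/-- The value in `k ⊕ R` of a tree whose angles are decorated by a list of elements of `V`. -/
def treeEval (D : TridendriformOps k R) (φ : V →ₗ[k] R) : PTree → List V → k × R
  | .leaf, _ => (1, 0)
  -- The first `a.numLeaves - 1` letters decorate the angles of `a`; the rest start with the first
  -- angle of the root.
  | .node a m b, l => (0, D.succU (treeEval D φ a (l.take (a.numLeaves - 1)))
      (treeEvalRest D φ m (treeEval D φ b) (l.drop (a.numLeaves - 1))).2)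
/-- The value of a tree with a leaf as its leftmost branch, from the other branches. -/
def treeEvalRest (D : TridendriformOps k R) (φ : V →ₗ[k] R) :
    List PTree → (List V → k × R) → List V → k × R
  | [], f, l => (0, D.precU (φ (l.headD 0)) (f l.tail))
  -- The `t.numLeaves` letters taken are the root angle to the left of `t` and the `t.numLeaves - 1`
  -- angles of `t`. The default head 0 is not reached for a word of the right length.
  | t :: ts, f, l => (0, D.dot
      (D.precU (φ ((l.take t.numLeaves).headD 0)) (treeEval D φ t (l.take t.numLeaves).tail))
      (treeEvalRest D φ ts f (l.drop t.numLeaves)).2)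
end

/-- The component in `R` of `treeEvalRest`. -/
def treeEvalList (D : TridendriformOps k R) (φ : V →ₗ[k] R) (m : List PTree)
    (f : List V → k × R) (l : List V) : R :=
  (treeEvalRest D φ m f l).2

variable {D : TridendriformOps k R} {φ : V →ₗ[k] R}

theorem treeEval_leaf (l : List V) : treeEval D φ .leaf l = (1, 0) := by rw [treeEval]

theorem treeEval_node_eq_inr (a : PTree) (m : List PTree) (b : PTree) (l : List V) :
    treeEval D φ (.node a m b) l = LinearMap.inr k k R
      (D.succU (treeEval D φ a (l.take (a.numLeaves - 1)))
        (treeEvalList D φ m (treeEval D φ b) (l.drop (a.numLeaves - 1)))) := by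
  rw [treeEval]
  rfl

theorem treeEvalList_nil_eq (f : List V → k × R) (l : List V) :
    treeEvalList D φ [] f l = D.precU (φ (l.headD 0)) (f l.tail) := by
  rw [treeEvalList, treeEvalRest]

theorem treeEvalList_cons_eq (t : PTree) (ts : List PTree) (f : List V → k × R) (l : List V) :
    treeEvalList D φ (t :: ts) f l = D.dot
      (D.precU (φ ((l.take t.numLeaves).headD 0)) (treeEval D φ t (l.take t.numLeaves).tail))
      (treeEvalList D φ ts f (l.drop t.numLeaves)) := by
  rw [treeEvalList, treeEvalRest]
  rfl

theorem treeEval_node {a : PTree} (m : List PTree) (b : PTree) {l : List V}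
    (hl : a.numLeaves = l.length + 1) (l' : List V) :
    treeEval D φ (.node a m b) (l ++ l') =
      LinearMap.inr k k R
        (D.succU (treeEval D φ a l) (treeEvalList D φ m (treeEval D φ b) l')) := by
  have : a.numLeaves - 1 = l.length := by omega
  rw [treeEval_node_eq_inr, this, List.take_left, List.drop_left]

theorem treeEvalList_cons (t : PTree) (ts : List PTree) (f : List V → k × R) (v : V)
    {l : List V} (hl : t.numLeaves = l.length + 1) (l' : List V) :
    treeEvalList D φ (t :: ts) f (v :: (l ++ l')) =
      D.dot (D.precU (φ v) (treeEval D φ t l)) (treeEvalList D φ ts f l') := by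
  have h : v :: (l ++ l') = (v :: l) ++ l' := rfl
  have h' : t.numLeaves = (v :: l).length := by simpa using hl
  rw [treeEvalList_cons_eq, h, h', List.take_left, List.drop_left]
  rfl

theorem treeEvalList_nil (f : List V → k × R) (v : V) (l : List V) :
    treeEvalList D φ [] f (v :: l) = D.precU (φ v) (f l) := by
  rw [treeEvalList_nil_eq]
  rfl

theorem exists_split_numLeaves {α : Type*} {t : PTree} {n : ℕ} {l : List α}
    (h : l.length = t.numLeaves + n) :
    ∃ v p q, l = v :: (p ++ q) ∧ t.numLeaves = p.length + 1 ∧ q.length = n := by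
  have ht := t.numLeaves_pos
  obtain ⟨v, l, rfl⟩ := List.exists_cons_of_length_pos (l := l) (by omega)
  simp only [List.length_cons] at h
  exact ⟨v, l.take (t.numLeaves - 1), l.drop (t.numLeaves - 1), by simp, by simp; omega,
    by simp; omega⟩

/-- By (x · y) ≺ z = x · (y ≺ z) the last branch acts on the whole product from the right; the
constant function `(1, 0)` puts a leaf in its place. -/
theorem treeEvalList_append_right (hD : IsTridendriform D) (m : List PTree) (f : List V → k × R)
    {l : List V} (hl : l.length = 1 + PTree.numLeavesList m) (l' : List V) :
    treeEvalList D φ m f (l ++ l') =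
      D.precU (treeEvalList D φ m (fun _ => (1, 0)) l) (f l') := by
  induction m generalizing l with
  | nil =>
    obtain ⟨v, rfl⟩ := List.length_eq_one_iff.mp
      (show l.length = 1 by simpa [PTree.numLeavesList] using hl)
    rw [List.singleton_append, treeEvalList_nil, treeEvalList_nil, TridendriformOps.precU_one]
  | cons t ts ih =>
    simp only [PTree.numLeavesList] at hl
    obtain ⟨v, p, q, rfl, hp, hq⟩ := exists_split_numLeaves
      (t := t) (n := 1 + PTree.numLeavesList ts) (l := l) (by omega)
    rw [List.cons_append, List.append_assoc, treeEvalList_cons t ts _ v hp,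
      treeEvalList_cons t ts _ v hp, ih hq, TridendriformOps.precU_dot hD]

/-- Isolates the branch created in the middle of T · T' when the two roots merge. -/
theorem treeEvalList_append_cons (hD : IsTridendriform D) (m m' : List PTree) {t : PTree}
    (f : List V → k × R) {l p : List V} (hl : l.length = 1 + PTree.numLeavesList m)
    (hp : t.numLeaves = p.length + 1) (l' : List V) :
    treeEvalList D φ (m ++ t :: m') f (l ++ (p ++ l')) =
      D.dot (D.precU (treeEvalList D φ m (fun _ => (1, 0)) l) (treeEval D φ t p))
        (treeEvalList D φ m' f l') := by
  induction m generalizing l with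
  | nil =>
    obtain ⟨v, rfl⟩ := List.length_eq_one_iff.mp
      (show l.length = 1 by simpa [PTree.numLeavesList] using hl)
    rw [List.singleton_append, List.nil_append, treeEvalList_cons t m' _ v hp, treeEvalList_nil,
      TridendriformOps.precU_one]
  | cons s ts ih =>
    simp only [PTree.numLeavesList] at hl
    obtain ⟨v, r, q, rfl, hr, hq⟩ := exists_split_numLeaves
      (t := s) (n := 1 + PTree.numLeavesList ts) (l := l) (by omega)
    simp only [List.cons_append, List.append_assoc]
    rw [treeEvalList_cons s _ _ v hr, treeEvalList_cons s ts _ v hr, ih hq,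
      TridendriformOps.precU_dot hD, hD.dot_dot]

/-- The sum of the values of the trees of a multiset. -/
def treeEvalSum (D : TridendriformOps k R) (φ : V →ₗ[k] R) (s : Multiset PTree) (l : List V) :
    k × R :=
  (s.map fun S => treeEval D φ S l).sum

/-- Grafting a tree as a branch is linear in its value, so a sum over b * T' can be evaluated before
grafting. -/
theorem treeEvalSum_map {s : Multiset PTree} {g : PTree → PTree} (L : (k × R) →ₗ[k] (k × R))
    {l l' : List V} (h : ∀ S ∈ s, treeEval D φ (g S) l = L (treeEval D φ S l')) :
    treeEvalSum D φ (s.map g) l = L (treeEvalSum D φ s l') := by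
  rw [treeEvalSum, treeEvalSum, Multiset.map_map, map_multiset_sum, Multiset.map_map]
  exact congrArg _ (Multiset.map_congr rfl h)

theorem PTree.numLeaves_of_mem_mstar {T T' S : PTree} (h : S ∈ PTree.mstar T T') :
    S.numLeaves + 1 = T.numLeaves + T'.numLeaves :=
  PTree.numLeaves_of_mem_star T T' S (by simpa [PTree.mstar] using h)

/-- The last branch is moved outermost, the form suited to ≺; the form of `treeEval_node`, with the
first branch outermost, suits ≻. -/
theorem treeEval_node_eq (hD : IsTridendriform D) {a b : PTree} {m : List PTree}
    {p q r : List V} (hp : a.numLeaves = p.length + 1)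
    (hq : q.length = 1 + PTree.numLeavesList m) :
    treeEval D φ (.node a m b) (p ++ (q ++ r)) = LinearMap.inr k k R
      (D.precU (D.succU (treeEval D φ a p) (treeEvalList D φ m (fun _ => (1, 0)) q))
        (treeEval D φ b r)) := by
  rw [treeEval_node m b hp, treeEvalList_append_right hD m _ hq,
    TridendriformOps.precU_succU hD]

theorem exists_split_node {α : Type*} {a b : PTree} {m : List PTree} {l : List α}
    (hl : (PTree.node a m b).numLeaves = l.length + 1) :
    ∃ p q r, l = p ++ (q ++ r) ∧ a.numLeaves = p.length + 1 ∧
      q.length = 1 + PTree.numLeavesList m ∧ b.numLeaves = r.length + 1 := by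
  have ha := a.numLeaves_pos
  have hb := b.numLeaves_pos
  simp only [PTree.numLeaves] at hl
  refine ⟨l.take (a.numLeaves - 1), (l.drop (a.numLeaves - 1)).take (1 + PTree.numLeavesList m),
    (l.drop (a.numLeaves - 1)).drop (1 + PTree.numLeavesList m), ?_, ?_, ?_, ?_⟩
  · rw [List.take_append_drop, List.take_append_drop]
  all_goals simp; omega

/-- With x the value of the tree without its last branch, this is (x ≺ b) ≺ T' = x ≺ (b * T'). Here
and in the next two lemmas, `h` is the induction hypothesis of `treeEvalSum_mstar`. -/
theorem treeEvalSum_mprec (hD : IsTridendriform D) {a b T' : PTree} {m : List PTree}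
    {p q r l' : List V} (hp : a.numLeaves = p.length + 1)
    (hq : q.length = 1 + PTree.numLeavesList m)
    (h : treeEvalSum D φ (PTree.mstar b T') (r ++ l') =
      D.starU (treeEval D φ b r) (treeEval D φ T' l')) :
    treeEvalSum D φ (PTree.mprec (.node a m b) T') (p ++ (q ++ r) ++ l') =
      LinearMap.inr k k R (D.precU (treeEval D φ (.node a m b) (p ++ (q ++ r))).2
        (treeEval D φ T' l')) := by
  rw [PTree.mprec_node, treeEvalSum_map (l' := r ++ l') (LinearMap.inr k k R ∘ₗ
    D.precU (D.succU (treeEval D φ a p) (treeEvalList D φ m (fun _ => (1, 0)) q))), h,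
    treeEval_node_eq hD hp hq, LinearMap.comp_apply]
  · simp only [LinearMap.inr_apply]
    rw [TridendriformOps.precU_precU hD]
  intro S _
  rw [List.append_assoc, List.append_assoc, treeEval_node_eq hD hp hq]
  rfl

theorem treeEvalSum_msucc (hD : IsTridendriform D) {T a b : PTree} {m : List PTree}
    {l p q : List V} (hl : T.numLeaves = l.length + 1) (hp : a.numLeaves = p.length + 1)
    (h : treeEvalSum D φ (PTree.mstar T a) (l ++ p) =
      D.starU (treeEval D φ T l) (treeEval D φ a p)) :
    treeEvalSum D φ (PTree.msucc T (.node a m b)) (l ++ (p ++ q)) =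
      LinearMap.inr k k R (D.succU (treeEval D φ T l)
        (treeEval D φ (.node a m b) (p ++ q)).2) := by
  rw [PTree.msucc_node, treeEvalSum_map (l' := l ++ p) (LinearMap.inr k k R ∘ₗ
    D.succU.flip (treeEvalList D φ m (treeEval D φ b) q)), h,
    treeEval_node m b hp, LinearMap.comp_apply, LinearMap.flip_apply]
  · simp only [LinearMap.inr_apply]
    rw [TridendriformOps.succU_succU hD]
  · intro S hS
    have := PTree.numLeaves_of_mem_mstar hS
    rw [← List.append_assoc, treeEval_node m b (by simp; omega)]
    rfl

theorem treeEvalSum_mdot (hD : IsTridendriform D) {a b a' b' : PTree} {m m' : List PTree}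
    {p q r p' q' : List V} (hp : a.numLeaves = p.length + 1)
    (hq : q.length = 1 + PTree.numLeavesList m) (hr : b.numLeaves = r.length + 1)
    (hp' : a'.numLeaves = p'.length + 1)
    (h : treeEvalSum D φ (PTree.mstar b a') (r ++ p') =
      D.starU (treeEval D φ b r) (treeEval D φ a' p')) :
    treeEvalSum D φ (PTree.mdot (.node a m b) (.node a' m' b')) (p ++ (q ++ r) ++ (p' ++ q')) =
      LinearMap.inr k k R (D.dot (treeEval D φ (.node a m b) (p ++ (q ++ r))).2
        (treeEval D φ (.node a' m' b') (p' ++ q')).2) := by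
  rw [PTree.mdot_node, treeEvalSum_map (l' := r ++ p') (LinearMap.inr k k R ∘ₗ
    D.succU (treeEval D φ a p) ∘ₗ D.dot.flip (treeEvalList D φ m' (treeEval D φ b') q') ∘ₗ
      D.precU (treeEvalList D φ m (fun _ => (1, 0)) q)), h]
  · rw [treeEval_node m' b' hp', treeEval_node_eq hD hp hq]
    simp only [LinearMap.comp_apply, LinearMap.inr_apply, LinearMap.flip_apply]
    rw [← TridendriformOps.precU_precU hD, TridendriformOps.dot_precU hD,
      TridendriformOps.succU_dot hD, TridendriformOps.precU_succU hD]
  · intro S hS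
    have := PTree.numLeaves_of_mem_mstar hS
    have hl : p ++ (q ++ r) ++ (p' ++ q') = p ++ (q ++ ((r ++ p') ++ q')) := by simp
    rw [hl, treeEval_node _ b' hp, treeEvalList_append_cons hD m m' _ hq (by simp; omega)]
    rfl

/-- The leaf goes to the unit; otherwise the three summands of `*` are evaluated separately, each
reducing to `*` of trees of smaller total size. -/
theorem treeEvalSum_mstar (hD : IsTridendriform D) : ∀ (T T' : PTree) {l l' : List V},
    T.numLeaves = l.length + 1 → T'.numLeaves = l'.length + 1 →
    treeEvalSum D φ (PTree.mstar T T') (l ++ l') =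
      D.starU (treeEval D φ T l) (treeEval D φ T' l')
  | .leaf, T', l, l', hl, _ => by
    obtain rfl : l = [] := List.length_eq_zero_iff.mp (by simpa [PTree.numLeaves] using hl)
    simp [treeEvalSum, treeEval_leaf, TridendriformOps.starU_one_left]
  | .node a m b, .leaf, l, l', _, hl' => by
    obtain rfl : l' = [] := List.length_eq_zero_iff.mp (by simpa [PTree.numLeaves] using hl')
    simp [treeEvalSum, treeEval_leaf, TridendriformOps.starU_one_right]
  | .node a m b, .node a' m' b', l, l', hl, hl' => by
    obtain ⟨p, q, r, rfl, hp, hq, hr⟩ := exists_split_node hl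
    obtain ⟨p', q', r', rfl, hp', hq', hr'⟩ := exists_split_node hl'
    have h1 := treeEvalSum_mprec hD (m := m) hp hq
      (treeEvalSum_mstar hD b (.node a' m' b') hr hl')
    have h2 := treeEvalSum_msucc hD (m := m') (b := b') (q := q' ++ r') hl hp'
      (treeEvalSum_mstar hD (.node a m b) a' hl hp')
    have h3 := treeEvalSum_mdot hD (m := m) (m' := m') (b' := b') (q' := q' ++ r') hp hq hr hp'
      (treeEvalSum_mstar hD b a' hr hp')
    have hadd : ∀ (s t : Multiset PTree) (l : List V),
        treeEvalSum D φ (s + t) l = treeEvalSum D φ s l + treeEvalSum D φ t l := by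
      simp [treeEvalSum]
    rw [PTree.mstar_eq (by simp) (by simp), hadd, hadd, h1, h2, h3, treeEval_node m b hp,
      treeEval_node m' b' hp']
    simp [TridendriformOps.starU, TridendriformOps.star]
termination_by T T' => sizeOf T + sizeOf T'

end Evaluation

-- Multilinear functions of lists.

section Multilinear

variable {k : Type*} [Field k] {V M M' N : Type*} [AddCommGroup V] [Module k V]
  [AddCommGroup M] [Module k M] [AddCommGroup M'] [Module k M'] [AddCommGroup N] [Module k N]

/-- A function of lists is linear in each entry of the lists of length `n`. -/
structure IsListMultilinear (k : Type*) [Field k] {V M : Type*} [AddCommGroup V] [Module k V]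
    [AddCommGroup M] [Module k M] (n : ℕ) (f : List V → M) : Prop where
  map_add : ∀ (l l' : List V) (x y : V), l.length + l'.length + 1 = n →
    f (l ++ (x + y) :: l') = f (l ++ x :: l') + f (l ++ y :: l')
  map_smul : ∀ (l l' : List V) (c : k) (x : V), l.length + l'.length + 1 = n →
    f (l ++ (c • x) :: l') = c • f (l ++ x :: l')

namespace IsListMultilinear

theorem zero_length (f : List V → M) : IsListMultilinear k 0 f :=
  ⟨fun _ _ _ _ h => by omega, fun _ _ _ _ h => by omega⟩

theorem comp {n : ℕ} {f : List V → M} (hf : IsListMultilinear k n f) (L : M →ₗ[k] N) :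
    IsListMultilinear k n fun l => L (f l) :=
  ⟨fun l l' x y h => by rw [hf.map_add l l' x y h, _root_.map_add],
    fun l l' c x h => by rw [hf.map_smul l l' c x h, _root_.map_smul]⟩

theorem mul {m n : ℕ} {f : List V → M} {g : List V → M'} (hf : IsListMultilinear k m f)
    (hg : IsListMultilinear k n g) (B : M →ₗ[k] M' →ₗ[k] N) :
    IsListMultilinear k (m + n) fun l => B (f (l.take m)) (g (l.drop m)) := by
  -- The varied entry falls either among the first `m` letters or among the others, and only the
  -- corresponding factor sees it.
  have key : ∀ (l l' : List V), l.length + l'.length + 1 = m + n →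
      (∃ r s, l' = r ++ s ∧ l.length + r.length + 1 = m ∧
        ∀ x, (l ++ x :: l').take m = l ++ x :: r ∧ (l ++ x :: l').drop m = s) ∨
      (∃ r s, l = r ++ s ∧ s.length + l'.length + 1 = n ∧
        ∀ x, (l ++ x :: l').take m = r ∧ (l ++ x :: l').drop m = s ++ x :: l') := by
    intro l l' h
    rcases Nat.lt_or_ge l.length m with hlt | hge
    · left
      obtain ⟨j, rfl⟩ : ∃ j, m = l.length + (j + 1) := ⟨m - l.length - 1, by omega⟩
      refine ⟨l'.take j, l'.drop j, by simp, by simp; omega, fun x => ⟨?_, ?_⟩⟩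
      · rw [List.take_length_add_append, List.take_succ_cons]
      · rw [List.drop_length_add_append, List.drop_succ_cons]
    · right
      refine ⟨l.take m, l.drop m, by simp, by simp; omega, fun x => ⟨?_, ?_⟩⟩
      · rw [List.take_append_of_le_length hge]
      · rw [List.drop_append_of_le_length hge]
  constructor
  · intro l l' x y h
    rcases key l l' h with ⟨r, s, -, hr, hx⟩ | ⟨r, s, -, hr, hx⟩
    · simp only [(hx _).1, (hx _).2, hf.map_add l r x y hr, _root_.map_add, LinearMap.add_apply]
    · simp only [(hx _).1, (hx _).2, hg.map_add s l' x y hr, _root_.map_add]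
  · intro l l' c x h
    rcases key l l' h with ⟨r, s, -, hr, hx⟩ | ⟨r, s, -, hr, hx⟩
    · simp only [(hx _).1, (hx _).2, hf.map_smul l r c x hr, _root_.map_smul, LinearMap.smul_apply]
    · simp only [(hx _).1, (hx _).2, hg.map_smul s l' c x hr, _root_.map_smul]

theorem head_tail {n : ℕ} {g : List V → M'} (hg : IsListMultilinear k n g)
    (B : V →ₗ[k] M' →ₗ[k] N) :
    IsListMultilinear k (n + 1) fun l => B (l.headD 0) (g l.tail) := by
  constructor
  · rintro (_ | ⟨v, l⟩) l' x y h
    · simp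
    · simp only [List.length_cons] at h
      simp [hg.map_add l l' x y (by omega)]
  · rintro (_ | ⟨v, l⟩) l' c x h
    · simp
    · simp only [List.length_cons] at h
      simp [hg.map_smul l l' c x (by omega)]

/-- The linear map on a tensor power given by a multilinear function of lists. -/
def toLinearMap {n : ℕ} {f : List V → M} (hf : IsListMultilinear k n f) :
    (⨂[k]^n V) →ₗ[k] M :=
  PiTensorProduct.lift
    { toFun := fun v => f (List.ofFn v)
      map_update_add' := by
        intro inst v i x y
        obtain rfl : inst = instDecidableEqFin n := Subsingleton.elim _ _
        have hi : (i : ℕ) < (List.ofFn v).length := by simp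
        simp only [ofFn_update, List.set_eq_take_append_cons_drop, hi, if_true]
        exact hf.map_add _ _ _ _ (by simp; omega)
      map_update_smul' := by
        intro inst v i c x
        obtain rfl : inst = instDecidableEqFin n := Subsingleton.elim _ _
        have hi : (i : ℕ) < (List.ofFn v).length := by simp
        simp only [ofFn_update, List.set_eq_take_append_cons_drop, hi, if_true]
        exact hf.map_smul _ _ _ _ (by simp; omega) }

theorem toLinearMap_tprod {n : ℕ} {f : List V → M} (hf : IsListMultilinear k n f)
    (v : Fin n → V) : hf.toLinearMap (PiTensorProduct.tprod k v) = f (List.ofFn v) :=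
  PiTensorProduct.lift.tprod _

end IsListMultilinear

end Multilinear

-- The induced homomorphism and the universal property.

section Lift

variable {k : Type*} [Field k] {V R : Type*} [AddCommGroup V] [Module k V] [AddCommGroup R]
  [Module k R] (D : TridendriformOps k R) (φ : V →ₗ[k] R)

mutual
-- The recursion cuts the list into disjoint pieces and uses each letter exactly once; the two
-- statements recurse on each other as the definitions do.
theorem isListMultilinear_treeEval :
    ∀ T : PTree, IsListMultilinear k (T.numLeaves - 1) (treeEval D φ T)
  | .leaf => by
    rw [show PTree.leaf.numLeaves - 1 = 0 by simp [PTree.numLeaves]]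
    exact IsListMultilinear.zero_length _
  | .node a m b => by
    have ha := a.numLeaves_pos
    have hb := b.numLeaves_pos
    have h := ((isListMultilinear_treeEval a).mul
      (isListMultilinear_treeEvalList m (isListMultilinear_treeEval b)) D.succU).comp
      (LinearMap.inr k k R)
    have hn : (PTree.node a m b).numLeaves - 1 =
        a.numLeaves - 1 + (PTree.numLeavesList m + (b.numLeaves - 1 + 1)) := by
      simp only [PTree.numLeaves]; omega
    rw [hn]
    convert h using 1
    funext l
    exact treeEval_node_eq_inr a m b l
theorem isListMultilinear_treeEvalList :
    ∀ (m : List PTree) {f : List V → k × R} {n : ℕ} (_ : IsListMultilinear k n f),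
      IsListMultilinear k (PTree.numLeavesList m + (n + 1)) (treeEvalList D φ m f)
  | [], f, n, hf => by
    have h := hf.head_tail (D.precU ∘ₗ φ)
    rw [show PTree.numLeavesList [] + (n + 1) = n + 1 by simp [PTree.numLeavesList]]
    convert h using 1
    funext l
    exact treeEvalList_nil_eq f l
  | t :: ts, f, n, hf => by
    have ht := t.numLeaves_pos
    have h1 := (isListMultilinear_treeEval t).head_tail (D.precU ∘ₗ φ)
    rw [Nat.sub_add_cancel ht] at h1
    have h := h1.mul (isListMultilinear_treeEvalList ts hf) D.dot
    rw [show PTree.numLeavesList (t :: ts) + (n + 1) =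
      t.numLeaves + (PTree.numLeavesList ts + (n + 1)) by simp only [PTree.numLeavesList]; omega]
    convert h using 1
    funext l
    exact treeEvalList_cons_eq t ts f l
end

theorem isListMultilinear_treeEval_snd {n : ℕ} (T : TreeOfDeg n) :
    IsListMultilinear k n fun l : List V => (treeEval D φ T.1 l).2 := by
  have h := (isListMultilinear_treeEval D φ T.1).comp (LinearMap.snd k k R)
  rwa [T.2, Nat.add_sub_cancel] at h

/-- The linear map `PlanarSpace k V → R` induced by `φ : V → R`. -/
def planarLift : PlanarSpace k V →ₗ[k] R :=
  DirectSum.toModule k ℕ+ R fun n =>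
    TensorProduct.lift (Finsupp.linearCombination k fun T : TreeOfDeg n =>
      (isListMultilinear_treeEval_snd D φ T).toLinearMap) ∘ₗ (componentEquiv k V n).toLinearMap

theorem planarLift_decorated_toTensorAlgebra {T : PTree} {n : ℕ+} (hT : T.numLeaves = n + 1)
    (x : ⨂[k]^(n : ℕ) V) :
    planarLift D φ (decorated T (TensorPower.toTensorAlgebra x)) =
      (isListMultilinear_treeEval_snd D φ (⟨T, hT⟩ : TreeOfDeg n)).toLinearMap x := by
  rw [decorated_toTensorAlgebra hT, planarLift, ofComponent, DirectSum.toModule_lof,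
    LinearMap.comp_apply, LinearEquiv.coe_coe, LinearEquiv.apply_symm_apply,
    TensorProduct.lift.tmul, Finsupp.linearCombination_single, one_smul]

theorem planarLift_decorated {T : PTree} {l : List V} (hT : T ≠ .leaf)
    (hl : T.numLeaves = l.length + 1) :
    planarLift D φ (decorated T (tensorWord k l)) = (treeEval D φ T l).2 := by
  have h1 := PTree.one_lt_numLeaves hT
  rw [tensorWord_eq_toTensorAlgebra]
  refine (planarLift_decorated_toTensorAlgebra D φ (n := ⟨l.length, by omega⟩) hl _).trans ?_
  refine (IsListMultilinear.toLinearMap_tprod _ _).trans ?_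
  exact congrArg (fun l => (treeEval D φ T l).2) (List.ofFn_get l)

theorem planarLift_planarIncl : planarLift D φ ∘ₗ planarIncl k V = φ := by
  ext v
  have h : TensorAlgebra.ι k v = tensorWord k [v] := by simp [tensorWord]
  rw [LinearMap.comp_apply, planarIncl_apply, h, planarLift_decorated D φ (by simp)
    (by simp [PTree.numLeaves, PTree.numLeavesList])]
  simp [treeEval_node_eq_inr, treeEvalList_nil_eq, treeEval_leaf, PTree.numLeaves]

variable {D}

theorem planarLift_decoratedSum {s : Multiset PTree} {l : List V}
    (hs : ∀ S ∈ s, S ≠ .leaf ∧ S.numLeaves = l.length + 1) :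
    planarLift D φ (decoratedSum s (tensorWord k l)) = (treeEvalSum D φ s l).2 := by
  have h : (treeEvalSum D φ s l).2 = LinearMap.snd k k R (treeEvalSum D φ s l) := rfl
  rw [h, treeEvalSum, decoratedSum, map_multiset_sum, map_multiset_sum, Multiset.map_map,
    Multiset.map_map]
  exact congrArg _ (Multiset.map_congr rfl fun S hS =>
    planarLift_decorated D φ (hs S hS).1 (hs S hS).2)

/-- Reduces the homomorphism property to single trees decorated by words, where the evaluation
lemmas apply. -/
theorem planarLift_product {μ : PlanarSpace k V →ₗ[k] PlanarSpace k V →ₗ[k] PlanarSpace k V}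
    {F : PTree → PTree → Multiset PTree} (h : IsTreeProduct μ F) (ν : R →ₗ[k] R →ₗ[k] R)
    (hν : ∀ {T T' : PTree} {l l' : List V}, T ≠ .leaf → T' ≠ .leaf →
      T.numLeaves = l.length + 1 → T'.numLeaves = l'.length + 1 →
      (treeEvalSum D φ (F T T') (l ++ l')).2 = ν (treeEval D φ T l).2 (treeEval D φ T' l').2)
    (x y : PlanarSpace k V) :
    planarLift D φ (μ x y) = ν (planarLift D φ x) (planarLift D φ y) := by
  have H : μ.compr₂ (planarLift D φ) = ν.compl₁₂ (planarLift D φ) (planarLift D φ) := by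
    refine planarSpace_hom_ext_word fun T l hT hl => planarSpace_hom_ext_word
      fun T' l' hT' hl' => ?_
    simp only [LinearMap.compr₂_apply, LinearMap.compl₁₂_apply]
    have h1 := PTree.one_lt_numLeaves hT
    have h2 := PTree.one_lt_numLeaves hT'
    rw [h.apply_word hT hT' hl hl', planarLift_decorated D φ hT hl,
      planarLift_decorated D φ hT' hl', planarLift_decoratedSum φ, hν hT hT' hl hl']
    -- Two trees other than the leaf have at least two leaves each, so every tree in their product
    -- has at least three and is not the leaf.
    intro S hS
    have := h.numLeaves hT hT' hS
    refine ⟨?_, by simp; omega⟩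
    rintro rfl
    simp only [PTree.numLeaves] at this
    omega
  exact LinearMap.congr_fun (LinearMap.congr_fun H x) y

theorem treeEval_eq_inr {T : PTree} (hT : T ≠ .leaf) (l : List V) :
    treeEval D φ T l = (0, (treeEval D φ T l).2) := by
  cases T with
  | leaf => exact absurd rfl hT
  | node a m b => rw [treeEval_node_eq_inr]; rfl

theorem planarLift_prec (hD : IsTridendriform D) (x y : PlanarSpace k V) :
    planarLift D φ ((planarOps k V).prec x y) =
      D.prec (planarLift D φ x) (planarLift D φ y) := by
  refine planarLift_product φ isTreeProduct_prec D.prec (fun {T T' l l'} hT hT' hl hl' => ?_) x y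
  cases T with
  | leaf => exact absurd rfl hT
  | node a m b =>
    obtain ⟨p, q, r, rfl, hp, hq, hr⟩ := exists_split_node hl
    rw [treeEvalSum_mprec hD hp hq (treeEvalSum_mstar hD b T' hr hl'), treeEval_eq_inr φ hT' l']
    simp

theorem planarLift_succ (hD : IsTridendriform D) (x y : PlanarSpace k V) :
    planarLift D φ ((planarOps k V).succ x y) =
      D.succ (planarLift D φ x) (planarLift D φ y) := by
  refine planarLift_product φ isTreeProduct_succ D.succ (fun {T T' l l'} hT hT' hl hl' => ?_) x y
  cases T' with
  | leaf => exact absurd rfl hT'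
  | node a m b =>
    obtain ⟨p, q, r, rfl, hp, hq, hr⟩ := exists_split_node hl'
    rw [treeEvalSum_msucc hD hl hp (treeEvalSum_mstar hD T a hl hp), treeEval_eq_inr φ hT l]
    simp

theorem planarLift_dot (hD : IsTridendriform D) (x y : PlanarSpace k V) :
    planarLift D φ ((planarOps k V).dot x y) =
      D.dot (planarLift D φ x) (planarLift D φ y) := by
  refine planarLift_product φ isTreeProduct_dot D.dot (fun {T T' l l'} hT hT' hl hl' => ?_) x y
  cases T with
  | leaf => exact absurd rfl hT
  | node a m b =>
    cases T' with
    | leaf => exact absurd rfl hT'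
    | node a' m' b' =>
      obtain ⟨p, q, r, rfl, hp, hq, hr⟩ := exists_split_node hl
      obtain ⟨p', q', r', rfl, hp', hq', hr'⟩ := exists_split_node hl'
      rw [treeEvalSum_mdot hD hp hq hr hp' (treeEvalSum_mstar hD b a' hr hp')]
      simp

theorem planarLift_isHom {σ : V ⊗[k] V →ₗ[k] V ⊗[k] V} (hσ : IsBraiding σ)
    {τ : R ⊗[k] R →ₗ[k] R ⊗[k] R} (hD : IsBraidedTridendriform D τ) (hφ : IsBraidedMap σ τ φ) :
    IsBraidedTridendriformHom (planarOps k V) (sigmaAT σ) D τ (planarLift D φ) where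
  map_prec := planarLift_prec φ hD.tridendriform
  map_succ := planarLift_succ φ hD.tridendriform
  map_dot := planarLift_dot φ hD.tridendriform
  braided := isBraidedMap_of_generators (isBraidedTridendriform_planarOps hσ) hD
    eq_top_of_planarIncl_mem (isBraidedMap_planarIncl σ)
    (by rwa [planarLift_planarIncl]) (planarLift_prec φ hD.tridendriform)
    (planarLift_succ φ hD.tridendriform) (planarLift_dot φ hD.tridendriform)

/-- A homomorphism out of `PlanarSpace k V` is determined by its values on `V`. -/
theorem planar_hom_unique {σ : V ⊗[k] V →ₗ[k] V ⊗[k] V} {τ : R ⊗[k] R →ₗ[k] R ⊗[k] R}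
    {f g : PlanarSpace k V →ₗ[k] R}
    (hf : IsBraidedTridendriformHom (planarOps k V) (sigmaAT σ) D τ f)
    (hg : IsBraidedTridendriformHom (planarOps k V) (sigmaAT σ) D τ g)
    (h : f ∘ₗ planarIncl k V = g ∘ₗ planarIncl k V) : f = g := by
  have hS : LinearMap.eqLocus f g = ⊤ := by
    refine eq_top_of_planarIncl_mem _ (fun v => LinearMap.congr_fun h v) ?_ ?_ ?_ <;>
      intro x hx y hy <;> rw [LinearMap.mem_eqLocus] at hx hy ⊢
    · rw [hf.map_prec, hg.map_prec, hx, hy]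
    · rw [hf.map_succ, hg.map_succ, hx, hy]
    · rw [hf.map_dot, hg.map_dot, hx, hy]
  exact LinearMap.ext fun x => (hS ▸ Submodule.mem_top : x ∈ LinearMap.eqLocus f g)

end Lift

end

end BraidedTree

theorem mainTheorem5 {k : Type*} [Field k] [CharZero k]
    {V : Type*} [AddCommGroup V] [Module k V]
    (σ : V ⊗[k] V →ₗ[k] V ⊗[k] V) (hσ : BraidedTree.IsBraiding σ) :
    BraidedTree.IsBraidedTridendriform (BraidedTree.planarOps k V) (BraidedTree.sigmaAT σ) ∧
    BraidedTree.IsBraidedMap σ (BraidedTree.sigmaAT σ) (BraidedTree.planarIncl k V) ∧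
    ∀ (R : Type*) [AddCommGroup R] [Module k R] (D : BraidedTree.TridendriformOps k R)
      (τ : R ⊗[k] R →ₗ[k] R ⊗[k] R), BraidedTree.IsBraidedTridendriform D τ →
      ∀ φ : V →ₗ[k] R, BraidedTree.IsBraidedMap σ τ φ →
        ∃! ψ : BraidedTree.PlanarSpace k V →ₗ[k] R,
          BraidedTree.IsBraidedTridendriformHom (BraidedTree.planarOps k V)
              (BraidedTree.sigmaAT σ) D τ ψ ∧
            ψ ∘ₗ BraidedTree.planarIncl k V = φ := by
  refine ⟨BraidedTree.isBraidedTridendriform_planarOps hσ, BraidedTree.isBraidedMap_planarIncl σ,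
    fun R _ _ D τ hD φ hφ => ⟨BraidedTree.planarLift D φ,
      ⟨BraidedTree.planarLift_isHom φ hσ hD hφ, BraidedTree.planarLift_planarIncl D φ⟩, ?_⟩⟩
  rintro ψ ⟨hψ, h⟩
  exact BraidedTree.planar_hom_unique hψ (BraidedTree.planarLift_isHom φ hσ hD hφ)
    (h.trans (BraidedTree.planarLift_planarIncl D φ).symm)
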